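/- Let $\Gamma$ be a finitely generated abelian group with a fixed isomorphism $\Gamma\cong\mathbb Z^{r_0}\times\mathbb Z_{p_1}^{r_1}\times\dots\times\mathbb Z_{p_a}^{r_a}$, where $r_0\ge1$ and $\mathbb Z_p$ is the cyclic group of order $p\ge1$; put $r=r_0+r_1+\dots+r_a$ and let $\varepsilon_1,\dots,\varepsilon_r\in\Gamma$ be the canonical generators. Let $X_0$ be the metric Cayley graph with vertex set $\Gamma$ and, for each $\gamma\in\Gamma$ and $1\le j\le r$, one edge $e_{\gamma,j}\cong[0,1]$ of length $1$ from $\gamma$ to $\gamma+\varepsilon_j$. Let $\mathcal v>0$ (the volume of the unscaled vertex neighbourhood), and let $Q_0$ be the non-negative self-adjoint operator in $L^2(X_0)\oplus\ell^2(\Gamma)$ associated with the quadratic form $$q_0(u,\psi)=\sum_{e}\|u_e'\|^2_{L^2(0,1)}$$ whose domain consists of the pairs $(u,\psi)\in L^2(X_0)\oplus\ell^2(\Gamma)$ such that $u_e\in H^1(0,1)$ for every edge $e$, $\sum_e\|u_e'\|^2<\infty$, and $\mathcal v^{1/2}u_e(\gamma)=\psi(\gamma)$ for every vertex $\gamma$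 and every edge end $e$ at $\gamma$. A spectral gap of $Q_0$ is a nonempty open interval $(a,b)$ disjoint from $\operatorname{spec}Q_0$ with $a,b\in\operatorname{spec}Q_0$. Then: 1. A real number $\lambda$ belongs to $\operatorname{spec}Q_0$ if and only if $\lambda=\omega^2$ for some $\omega\ge0$ such that either $\omega=k\pi$ with an integer $k\ge1$, or $$\cos\omega-\frac{\mathcal v\,\omega\sin\omega}{2r}=\frac1r\sum_{j=1}^r\cos\theta_j$$ for some angles $\theta=(\theta_1,\dots,\theta_r)$ of a character of $\Gamma$, that is, $\theta_j\in\mathbb R$ is arbitrary when the $j$-th factor is $\mathbb Z$, and $p\,\theta_j\in2\pi\mathbb Z$ when the $j$-th factor is $\mathbb Z_p$. 2. For all sufficiently large integers $\ell$ there is a spectral gap of $Q_0$ containing $(2\ell+1)^2\pi^2/4$, and infinitely many different spectral gaps arise as gaps containing a point of this form. 3. If at least one of the orders $p_1,\dots,p_a$ is odd, then for every $\ell=0,1,2,\dots$ there are spectral gaps directly below and directly above $(2\ell+1)^2\pi^2$: there are $a<(2\ell+1)^2\pi^2<b$ such that $(a,(2\ell+1)^2\pi^2)$ and $((2\ell+1)^2\pi^2,b)$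 are spectral gaps of $Q_0$. -/

import Mathlib

noncomputable section

open MeasureTheory

namespace BorderlineGraph

/-- `L²([0,1])`, the Hilbert space of one edge (all edges have length `1` and weight `1`). -/
abbrev EdgeSpace : Type := Lp ℂ 2 (volume.restrict (Set.Icc (0 : ℝ) 1))

/-- `L²(X₀)` for a metric graph `X₀` with edge set `E`: the `ℓ²`-sum of the edge spaces. -/
abbrev GraphL2 (E : Type*) : Type _ := lp (fun _ : E => EdgeSpace) 2

/-- The extended Hilbert space `L²(X₀) ⊕ ℓ²(V)`, with its Hilbert space inner product. -/
abbrev ExtSpace (E V : Type*) : Type _ :=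
  WithLp 2 (GraphL2 E × lp (fun _ : V => ℂ) 2)

/-- `u` lies in the Sobolev space `H¹(0,1)`, with weak derivative `v ∈ L²(0,1)`, and its
continuous representative takes the values `a` at `0` and `b` at `1`. -/
def IsEdgeH1 (u v : EdgeSpace) (a b : ℂ) : Prop :=
  (∀ᵐ x ∂(volume.restrict (Set.Icc (0 : ℝ) 1)), u x = a + ∫ t in (0 : ℝ)..x, v t) ∧
    b = a + ∫ t in (0 : ℝ)..1, v t

/-- `InFormDomain src tgt vol U D`: the element `U = (u, ψ)` of `L²(X₀) ⊕ ℓ²(V)` lies in the form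
domain of the borderline quadratic form, and `D = u' ∈ L²(X₀)` is its edgewise derivative.
The edge `e` is identified with `[0,1]`, runs from `src e` to `tgt e`, and
the values of `u` at its endpoints are coupled to `ψ` by `vol^{1/2} u_e(v) = ψ(v)`. -/
def InFormDomain {E V : Type*} (src tgt : E → V) (vol : ℝ)
    (U : ExtSpace E V) (D : GraphL2 E) : Prop :=
  ∀ e : E, ∃ a b : ℂ, IsEdgeH1 (U.fst e) (D e) a b ∧
    (Real.sqrt vol : ℂ) * a = U.snd (src e) ∧ (Real.sqrt vol : ℂ) * b = U.snd (tgt e)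

/-- The operator `Q₀` associated with the quadratic form `q₀(u, ψ) = ∑ₑ ‖uₑ'‖²`, given by its
graph: `IsLimitOp src tgt vol U W` says that `U ∈ dom Q₀` and `Q₀ U = W`, that is, `U` is in the
form domain and `q₀(V, U) = ⟪V, W⟫` for all `V` in the form domain. -/
def IsLimitOp {E V : Type*} (src tgt : E → V) (vol : ℝ) (U W : ExtSpace E V) : Prop :=
  ∃ D : GraphL2 E, InFormDomain src tgt vol U D ∧
    ∀ (U' : ExtSpace E V) (D' : GraphL2 E), InFormDomain src tgt vol U' D' →
      inner ℂ D' D = inner ℂ U' W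

/-- The spectrum of an unbounded operator given by its graph `Q`: `z` is outside the spectrum iff
`Q - z`, from the domain of `Q` to the whole space, has a bounded everywhere defined inverse `R`. -/
def opSpectrum {H : Type*} [NormedAddCommGroup H] [NormedSpace ℂ H] (Q : H → H → Prop) : Set ℂ :=
  {z | ¬ ∃ R : H →L[ℂ] H, ∀ U F : H, (∃ W, Q U W ∧ W - z • U = F) ↔ U = R F}

/-- The real points of the spectrum of the limit operator `Q₀` on the metric Cayley graph of the
abelian group `Γ` with generators `g 0, …, g (r - 1)`, with vertex volume `vol`: the vertices are
the elements of `Γ`, and for each `γ` and `j` there is one edge, of length `1`, from `γ` to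
`γ + g j`. -/
def cayleySpectrum {Γ : Type*} [AddCommGroup Γ] {r : ℕ} (g : Fin r → Γ) (vol : ℝ) : Set ℝ :=
  {x | (x : ℂ) ∈ opSpectrum
    (IsLimitOp (fun e : Γ × Fin r => e.1) (fun e : Γ × Fin r => e.1 + g e.2) vol)}

/-- `(a, b)` is a (maximal, bounded) spectral gap: a nonempty open interval free of spectrum whose
endpoints are in the spectrum. -/
def IsSpectralGap (S : Set ℝ) (a b : ℝ) : Prop :=
  a < b ∧ a ∈ S ∧ b ∈ S ∧ Disjoint (Set.Ioo a b) S

/-- The angles `θ` of the characters of `∏ⱼ ℤ/nⱼℤ`: `nⱼ θⱼ ∈ 2πℤ` for every `j`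
(no condition on `θⱼ` when `nⱼ = 0`, as then the factor is `ℤ`). -/
def IsCharacterAngle {r : ℕ} (n : Fin r → ℕ) (θ : Fin r → ℝ) : Prop :=
  ∀ j, ∃ m : ℤ, (n j : ℝ) * θ j = 2 * Real.pi * m

end BorderlineGraph

end

noncomputable section

open MeasureTheory

namespace BorderlineGraph


/-! Write `c`, `s` for the solutions of `-f'' = λf` on `[0,1]` with data `(1,0)` and `(0,1)` at `0`,
and `c1`, `s1` for their values at `1`. All calculus on an edge is done with the Volterra operator
`J`: `u ∈ H¹` means `u = a·1 + J u'`, integration by parts is `J + J* = |1⟩⟨1|`, and unique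
solvability of the initial value problem is quasi-nilpotency of `J`.

If `s1 ≠ 0`, a solution on the edges is determined by its vertex values `φ`, and Green's formula
(`IsFundamental.green`) turns the balance of fluxes at the vertices into `(2r c1 - λ vol s1) φ = A
φ`, with `A` the adjacency operator of the Cayley graph. A bounded inverse of this difference bounds
`(Q₀ - λ)⁻¹` (`IsFundamental.not_mem_cayleySpectrum`), and approximate eigenvectors of `A` lift to
approximate eigenvectors of `Q₀` (`IsFundamental.mem_cayleySpectrum_of_adjacency`). If `s1 = 0`,
then `c1 = ±1`, and `s` itself is placed on the edges of a line in a `ℤ` direction with slowly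
decaying amplitudes, so `λ` is always in the spectrum (`IsFundamental.mem_cayleySpectrum_of_flow`).

The spectrum of `A` is the set of `∑ 2 cos θ_j` over the characters: one inclusion is Gelfand theory
for the closed commutative algebra generated by the translations (`adjacency_bound`), the other uses
damped characters (`exists_approx`). With `c1 = cos ω` and `s1 = sin ω / ω` this is the dispersion
relation.

For the gaps, the means of cosines form a closed subset of `[-1,1]`. At `ω = (2l+1)π/2` the left
side has modulus `vol ω / (2r)`, which exceeds `1` for large `l`. At `ω = (2l+1)π` it is `-1`, which
is not a mean when some order is odd; so this spectral point, present because `s1 = 0`, is isolated.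
-/

/-! ### The Volterra operator on a single edge. -/

lemma memLp_primitive (v : EdgeSpace) :
    MemLp (fun x : ℝ => ∫ t in (0 : ℝ)..x, v t) 2 (volume.restrict (Set.Icc (0 : ℝ) 1)) ∧
      ∀ x ∈ Set.Icc (0 : ℝ) 1, ‖∫ t in (0 : ℝ)..x, v t‖ ≤ ‖v‖ := by
  have hv : IntegrableOn v (Set.Icc (0 : ℝ) 1) volume :=
    (Lp.memLp v).integrable (by norm_num)
  have hb : ∀ x ∈ Set.Icc (0 : ℝ) 1, ‖∫ t in (0 : ℝ)..x, v t‖ ≤ ‖v‖ := by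
    intro x hx
    rw [intervalIntegral.integral_of_le hx.1]
    calc ‖∫ t in Set.Ioc 0 x, v t‖ ≤ ∫ t in Set.Ioc 0 x, ‖v t‖ := norm_integral_le_integral_norm _
      _ ≤ ∫ t in Set.Icc 0 1, ‖v t‖ := by
          apply setIntegral_mono_set hv.norm (Filter.Eventually.of_forall fun _ => norm_nonneg _)
          exact LE.le.eventuallyLE
            (show Set.Ioc 0 x ⊆ Set.Icc (0 : ℝ) 1 from fun t ht => ⟨ht.1.le, ht.2.trans hx.2⟩)
      _ ≤ ‖v‖ := by
          rw [integral_norm_eq_lintegral_enorm hv.1, Lp.norm_def]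
          apply ENNReal.toReal_mono (Lp.eLpNorm_ne_top v)
          rw [← eLpNorm_one_eq_lintegral_enorm]
          have : IsProbabilityMeasure (volume.restrict (Set.Icc (0 : ℝ) 1)) := ⟨by simp⟩
          exact eLpNorm_le_eLpNorm_of_exponent_le (by norm_num) hv.1
  refine ⟨?_, hb⟩
  refine MemLp.of_bound ?_ ‖v‖ ?_
  · apply ContinuousOn.aestronglyMeasurable _ measurableSet_Icc
    have := intervalIntegral.continuousOn_primitive_interval (μ := volume) (f := v) (a := 0) (b := 1)
      (by simpa using hv)
    simpa using this
  · exact (ae_restrict_iff' measurableSet_Icc).2 (Filter.Eventually.of_forall hb)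

lemma intervalIntegrable_edge (v : EdgeSpace) {x : ℝ} (hx : x ∈ Set.Icc (0 : ℝ) 1) :
    IntervalIntegrable v volume 0 x := by
  have hv : IntegrableOn v (Set.Icc (0 : ℝ) 1) volume :=
    (Lp.memLp v).integrable (by norm_num)
  rw [intervalIntegrable_iff_integrableOn_Ioc_of_le hx.1]
  exact hv.mono_set fun t ht => ⟨ht.1.le, ht.2.trans hx.2⟩

lemma primitive_congr {f g : ℝ → ℂ} (h : f =ᵐ[volume.restrict (Set.Icc (0 : ℝ) 1)] g) {x : ℝ}
    (hx : x ∈ Set.Icc (0 : ℝ) 1) : ∫ t in (0 : ℝ)..x, f t = ∫ t in (0 : ℝ)..x, g t := by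
  rw [intervalIntegral.integral_of_le hx.1, intervalIntegral.integral_of_le hx.1]
  apply integral_congr_ae
  have hsub : Set.Ioc 0 x ⊆ Set.Icc (0 : ℝ) 1 := fun t ht => ⟨ht.1.le, ht.2.trans hx.2⟩
  exact ae_restrict_of_ae_restrict_of_subset hsub h

/-- The Volterra operator `(J v)(x) = ∫₀ˣ v` on `L²([0,1])`. -/
def volterra : EdgeSpace →L[ℂ] EdgeSpace :=
  LinearMap.mkContinuous
    { toFun := fun v => (memLp_primitive v).1.toLp _
      map_add' := by
        intro u v
        rw [← MemLp.toLp_add]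
        apply MemLp.toLp_congr
        refine (ae_restrict_iff' measurableSet_Icc).2 (Filter.Eventually.of_forall fun x hx => ?_)
        simp only [Pi.add_apply]
        rw [primitive_congr (Lp.coeFn_add u v) hx]
        exact intervalIntegral.integral_add (intervalIntegrable_edge u hx)
          (intervalIntegrable_edge v hx)
      map_smul' := by
        intro a v
        rw [RingHom.id_apply, ← MemLp.toLp_const_smul]
        apply MemLp.toLp_congr
        refine (ae_restrict_iff' measurableSet_Icc).2 (Filter.Eventually.of_forall fun x hx => ?_)
        simp only [Pi.smul_apply]
        rw [primitive_congr (Lp.coeFn_smul a v) hx]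
        exact intervalIntegral.integral_smul a _ } 1 (by
    intro v
    rw [one_mul]
    refine (Lp.norm_le_of_ae_bound (norm_nonneg v) (C := ‖v‖) ?_).trans ?_
    · filter_upwards [(memLp_primitive v).1.coeFn_toLp, ae_restrict_mem measurableSet_Icc]
        with x h1 h2
      exact (congrArg norm h1).trans_le ((memLp_primitive v).2 x h2)
    · simp [measureUnivNNReal])

lemma volterra_ae (v : EdgeSpace) : volterra v =ᵐ[volume.restrict (Set.Icc (0 : ℝ) 1)]
    fun x => ∫ t in (0 : ℝ)..x, v t :=
  (memLp_primitive v).1.coeFn_toLp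

lemma memLp_ofReal_continuous {f : ℝ → ℝ} (hf : Continuous f) :
    MemLp (fun x => (f x : ℂ)) 2 (volume.restrict (Set.Icc (0 : ℝ) 1)) := by
  obtain ⟨C, hC⟩ := isCompact_Icc.exists_bound_of_continuousOn
    (f := f) (s := Set.Icc (0 : ℝ) 1) hf.continuousOn
  refine MemLp.of_bound (by fun_prop) C ?_
  refine (ae_restrict_iff' measurableSet_Icc).2 (Filter.Eventually.of_forall fun x hx => ?_)
  simpa using hC x hx

/-- The element of `L²([0,1])` given by a continuous real function. -/
def edgeOf (f : ℝ → ℝ) (hf : Continuous f) : EdgeSpace := (memLp_ofReal_continuous hf).toLp _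

/-- The constant function `1` in `L²([0,1])`. -/
def edgeOne : EdgeSpace := edgeOf (fun _ => 1) continuous_const

lemma edgeOf_ae (f : ℝ → ℝ) (hf : Continuous f) :
    edgeOf f hf =ᵐ[volume.restrict (Set.Icc (0 : ℝ) 1)] fun x => (f x : ℂ) :=
  (memLp_ofReal_continuous hf).coeFn_toLp

lemma volterra_edgeOf {f g : ℝ → ℝ} (hf : Continuous f) (hg : Continuous g)
    (h : ∀ x, HasDerivAt g (f x) x) :
    volterra (edgeOf f hf) = edgeOf g hg - (g 0 : ℂ) • edgeOne := by
  apply Lp.ext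
  filter_upwards [volterra_ae (edgeOf f hf), Lp.coeFn_sub (edgeOf g hg) ((g 0 : ℂ) • edgeOne),
    Lp.coeFn_smul (g 0 : ℂ) edgeOne, edgeOf_ae g hg, edgeOf_ae (fun _ => 1) continuous_const,
    ae_restrict_mem measurableSet_Icc] with x h1 h2 h3 h4 h5 hx
  rw [h1, h2, Pi.sub_apply, h3, Pi.smul_apply, h4, edgeOne, h5,
    primitive_congr (edgeOf_ae f hf) hx, intervalIntegral.integral_ofReal,
    intervalIntegral.integral_eq_sub_of_hasDerivAt (fun t _ => h t) (hf.intervalIntegrable _ _)]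
  simp

lemma inner_edgeOne (v : EdgeSpace) : inner ℂ edgeOne v = ∫ t in (0 : ℝ)..1, v t := by
  rw [L2.inner_def, intervalIntegral.integral_of_le zero_le_one, ← integral_Icc_eq_integral_Ioc]
  apply integral_congr_ae
  filter_upwards [edgeOf_ae (fun _ => 1) continuous_const] with x hx
  rw [edgeOne, hx]
  simp

lemma inner_edgeOne_edgeOf {f g : ℝ → ℝ} (hf : Continuous f)
    (h : ∀ x, HasDerivAt g (f x) x) :
    inner ℂ edgeOne (edgeOf f hf) = ((g 1 - g 0 : ℝ) : ℂ) := by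
  rw [inner_edgeOne, primitive_congr (edgeOf_ae f hf) (by simp), intervalIntegral.integral_ofReal,
    intervalIntegral.integral_eq_sub_of_hasDerivAt (fun t _ => h t) (hf.intervalIntegrable _ _)]

/-- Replaces the almost-everywhere description of `H¹` by identities in `L²`, so that the rest is
operator algebra. -/
lemma isEdgeH1_iff (u v : EdgeSpace) (a b : ℂ) :
    IsEdgeH1 u v a b ↔ u = a • edgeOne + volterra v ∧ b = a + inner ℂ edgeOne v := by
  rw [inner_edgeOne, IsEdgeH1]
  refine and_congr_left fun _ => ?_
  have key : (a • edgeOne + volterra v : EdgeSpace) =ᵐ[volume.restrict (Set.Icc (0 : ℝ) 1)]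
      fun x => a + ∫ t in (0 : ℝ)..x, v t := by
    filter_upwards [Lp.coeFn_add (a • edgeOne) (volterra v), Lp.coeFn_smul a edgeOne,
      edgeOf_ae (fun _ => 1) continuous_const, volterra_ae v] with x h1 h2 h3 h4
    rw [h1, Pi.add_apply, h2, Pi.smul_apply, h4, edgeOne, h3]
    simp
  constructor
  · intro h
    exact Lp.ext (Filter.EventuallyEq.trans h key.symm)
  · rintro rfl
    exact key

/-- Integration by parts in the form `J + J* = |1⟩⟨1|`. By Fubini the two terms integrate `conj (w
x) * v t` over the triangle `t ≤ x` and over its complement in the unit square. -/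
lemma inner_volterra_add (v w : EdgeSpace) :
    inner ℂ w (volterra v) + inner ℂ (volterra w) v =
      inner ℂ w edgeOne * inner ℂ edgeOne v := by
  set μ := volume.restrict (Set.Icc (0 : ℝ) 1) with hμ
  have hv : Integrable v μ := (Lp.memLp v).integrable (by norm_num)
  have hw : Integrable w μ := (Lp.memLp w).integrable (by norm_num)
  have hw' : Integrable (fun x => (starRingEnd ℂ) (w x)) μ :=
    (RCLike.conjCLE (K := ℂ)).toContinuousLinearMap.integrable_comp hw
  have hF : Integrable (fun p : ℝ × ℝ => (starRingEnd ℂ) (w p.1) * v p.2) (μ.prod μ) :=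
    hw'.mul_prod hv
  set F : ℝ × ℝ → ℂ := fun p => (starRingEnd ℂ) (w p.1) * v p.2 with hFdef
  have hs : MeasurableSet {p : ℝ × ℝ | p.2 ≤ p.1} := measurableSet_le measurable_snd measurable_fst
  have hsub : ∀ x ∈ Set.Icc (0 : ℝ) 1, ∀ f : ℝ → ℂ,
      ∫ t in (0 : ℝ)..x, f t = ∫ t, (Set.Iic x).indicator f t ∂μ := by
    intro x hx f
    rw [intervalIntegral.integral_of_le hx.1, integral_indicator measurableSet_Iic, hμ,
      Measure.restrict_restrict measurableSet_Iic, ← integral_Icc_eq_integral_Ioc]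
    congr 2
    ext t
    simp only [Set.mem_Icc, Set.mem_inter_iff, Set.mem_Iic]
    constructor
    · rintro ⟨h1, h2⟩; exact ⟨h2, h1, h2.trans hx.2⟩
    · rintro ⟨h1, h2, _⟩; exact ⟨h2, h1⟩
  have hsub' : ∀ x ∈ Set.Icc (0 : ℝ) 1, ∀ f : ℝ → ℂ,
      ∫ t in (0 : ℝ)..x, f t = ∫ t, (Set.Iio x).indicator f t ∂μ := by
    intro x hx f
    rw [intervalIntegral.integral_of_le hx.1, integral_indicator measurableSet_Iio, hμ,
      Measure.restrict_restrict measurableSet_Iio, integral_Ioc_eq_integral_Ioo,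
      ← integral_Ico_eq_integral_Ioo]
    congr 2
    ext t
    simp only [Set.mem_Icc, Set.mem_inter_iff, Set.mem_Iio, Set.mem_Ico]
    constructor
    · rintro ⟨h1, h2⟩; exact ⟨h2, h1, h2.le.trans hx.2⟩
    · rintro ⟨h1, h2, _⟩; exact ⟨h2, h1⟩
  have e1 : inner ℂ w (volterra v) = ∫ p, {p : ℝ × ℝ | p.2 ≤ p.1}.indicator F p ∂(μ.prod μ) := by
    rw [integral_prod _ (hF.indicator hs), L2.inner_def]
    apply integral_congr_ae
    filter_upwards [volterra_ae v, ae_restrict_mem measurableSet_Icc] with x h1 hx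
    rw [h1, hsub x hx, RCLike.inner_apply, mul_comm, ← integral_const_mul]
    congr 1
    ext t
    simp only [Set.indicator, Set.mem_Iic, Set.mem_ofPred_eq, hFdef]
    split_ifs <;> simp
  have e2 : inner ℂ (volterra w) v =
      ∫ p, {p : ℝ × ℝ | p.2 ≤ p.1}ᶜ.indicator F p ∂(μ.prod μ) := by
    rw [integral_prod_symm _ (hF.indicator hs.compl), L2.inner_def]
    apply integral_congr_ae
    filter_upwards [volterra_ae w, ae_restrict_mem measurableSet_Icc] with x h1 hx
    rw [h1, hsub' x hx, RCLike.inner_apply, ← integral_conj, ← integral_const_mul]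
    congr 1
    ext t
    simp only [Set.indicator, Set.mem_Iio, Set.mem_ofPred_eq, Set.mem_compl_iff, not_le, hFdef]
    split_ifs <;> simp [mul_comm]
  have e3 : inner ℂ w edgeOne * inner ℂ edgeOne v = ∫ p, F p ∂(μ.prod μ) := by
    simp only [hFdef]
    rw [integral_prod_mul (fun x => (starRingEnd ℂ) (w x)) (fun x => v x), inner_edgeOne,
      intervalIntegral.integral_of_le zero_le_one, ← integral_Icc_eq_integral_Ioc, L2.inner_def]
    congr 1
    apply integral_congr_ae
    filter_upwards [edgeOf_ae (fun _ => 1) continuous_const] with x hx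
    rw [edgeOne, hx]
    simp
  rw [e1, e2, e3, ← integral_add (hF.indicator hs) (hF.indicator hs.compl)]
  congr 1
  ext p
  exact congrFun (Set.indicator_self_add_compl _ F) p

lemma volterra_pow_bound (v : EdgeSpace) (n : ℕ) :
    ∀ᵐ x ∂(volume.restrict (Set.Icc (0 : ℝ) 1)),
      ‖(volterra ^ (n + 1)) v x‖ ≤ ‖v‖ * (x ^ n / n.factorial) := by
  induction n with
  | zero =>
    filter_upwards [volterra_ae v, ae_restrict_mem measurableSet_Icc] with x h1 h2
    simpa [h1] using (memLp_primitive v).2 x h2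
  | succ n ih =>
    rw [pow_succ']
    change ∀ᵐ x ∂_, ‖(volterra ((volterra ^ (n + 1)) v)) x‖ ≤ _
    filter_upwards [volterra_ae ((volterra ^ (n + 1)) v), ae_restrict_mem measurableSet_Icc]
      with x h1 hx
    rw [h1]
    calc ‖∫ t in (0 : ℝ)..x, ((volterra ^ (n + 1)) v) t‖
        ≤ ∫ t in (0 : ℝ)..x, ‖v‖ * (t ^ n / n.factorial) := by
          apply intervalIntegral.norm_integral_le_of_norm_le hx.1
          · have := (ae_restrict_iff' measurableSet_Icc).1 ih
            filter_upwards [this] with t ht ht'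
            exact ht ⟨ht'.1.le, ht'.2.trans hx.2⟩
          · apply Continuous.intervalIntegrable
            fun_prop
      _ = ‖v‖ * (x ^ (n + 1) / (n + 1).factorial) := by
          rw [intervalIntegral.integral_const_mul, intervalIntegral.integral_div, integral_pow,
            Nat.factorial_succ]
          push_cast
          field_simp
          simp

lemma norm_volterra_pow_le (n : ℕ) : ‖volterra ^ (n + 1)‖ ≤ 1 / (n.factorial : ℝ) := by
  refine ContinuousLinearMap.opNorm_le_bound _ (by positivity) fun v => ?_
  refine (Lp.norm_le_of_ae_bound (C := ‖v‖ * (1 / n.factorial)) (by positivity) ?_).trans ?_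
  · filter_upwards [volterra_pow_bound v n, ae_restrict_mem measurableSet_Icc] with x h1 hx
    refine h1.trans ?_
    gcongr
    exact pow_le_one₀ hx.1 hx.2
  · simp [measureUnivNNReal, mul_comm]

/-- The factorial decay of `‖J ^ n‖` makes some power of `X = -z J²` have norm below `1`, for every
`z`. Then `1 - X` is a factor, commuting with its cofactor, of the unit `1 - X ^ (n + 1)`. -/
lemma isUnit_one_add_smul_volterra_sq (z : ℂ) :
    IsUnit (1 + z • volterra ^ 2 : EdgeSpace →L[ℂ] EdgeSpace) := by
  have hlim := FloorSemiring.tendsto_pow_div_factorial_atTop (‖z‖ + 1)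
  obtain ⟨n, hn⟩ : ∃ n : ℕ, (‖z‖ + 1) * ((‖z‖ + 1) ^ n / n.factorial) < 1 := by
    have h2 := hlim.const_mul (‖z‖ + 1)
    rw [mul_zero] at h2
    exact (h2.eventually (gt_mem_nhds one_pos)).exists
  set X : EdgeSpace →L[ℂ] EdgeSpace := -(z • volterra ^ 2) with hX
  have hXn : ‖X ^ (n + 1)‖ < 1 := by
    have : X ^ (n + 1) = (-z) ^ (n + 1) • (volterra ^ (n + 1) * volterra ^ (n + 1)) := by
      rw [hX, ← neg_smul, smul_pow, ← pow_mul, ← pow_add]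
      congr 2
      ring
    rw [this, norm_smul, norm_pow, norm_neg]
    have h1 := norm_volterra_pow_le n
    have h2 : ‖volterra ^ (n + 1)‖ ≤ 1 := h1.trans (by
      rw [div_le_one (by positivity)]
      exact_mod_cast Nat.factorial_pos n)
    calc ‖z‖ ^ (n + 1) * ‖volterra ^ (n + 1) * volterra ^ (n + 1)‖
        ≤ (‖z‖ + 1) ^ (n + 1) * (1 / n.factorial * 1) := by
          gcongr
          · linarith
          · exact (norm_mul_le _ _).trans (by gcongr)
      _ = (‖z‖ + 1) * ((‖z‖ + 1) ^ n / n.factorial) := by ring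
      _ < 1 := hn
  have hu : IsUnit (1 - X ^ (n + 1)) := isUnit_one_sub_of_norm_lt_one hXn
  have h3 : (1 - X) * ∑ i ∈ Finset.range (n + 1), X ^ i = 1 - X ^ (n + 1) := mul_neg_geom_sum X _
  have hc : Commute (1 - X) (∑ i ∈ Finset.range (n + 1), X ^ i) := by
    apply Commute.sum_right
    intro i _
    exact ((Commute.one_left X).sub_left (Commute.refl X)).pow_right i
  rw [← h3, hc.isUnit_mul_iff] at hu
  have := hu.1
  rwa [hX, sub_neg_eq_add] at this


/-! ### Bounded operators on `ℓ²`-sums, shifts and pull-backs. -/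

section lpMap

variable {ι X Y : Type*} [NormedAddCommGroup X]

lemma sum_sq_le_norm_sq (x : lp (fun _ : ι => X) 2) (s : Finset ι) :
    ∑ i ∈ s, ‖x i‖ ^ 2 ≤ ‖x‖ ^ 2 := by
  have := lp.sum_rpow_le_norm_rpow (p := 2) (by norm_num) x s
  simpa using this

lemma memlp_two_of_sum_le {f : ι → X} {C : ℝ} (h : ∀ s : Finset ι, ∑ i ∈ s, ‖f i‖ ^ 2 ≤ C) :
    Memℓp f 2 := by
  refine memℓp_gen' (C := C) fun s => ?_
  simpa using h s

lemma norm_le_of_sum_sq_le {x : lp (fun _ : ι => X) 2} {C : ℝ} (hC : 0 ≤ C)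
    (h : ∀ s : Finset ι, ∑ i ∈ s, ‖x i‖ ^ 2 ≤ C ^ 2) : ‖x‖ ≤ C := by
  refine lp.norm_le_of_forall_sum_le (by norm_num) hC fun s => ?_
  simpa using h s

variable [NormedSpace ℂ X] [NormedAddCommGroup Y] [NormedSpace ℂ Y]

lemma sum_sq_map_le (T : X →L[ℂ] Y) (x : lp (fun _ : ι => X) 2) (s : Finset ι) :
    ∑ i ∈ s, ‖T (x i)‖ ^ 2 ≤ (‖T‖ * ‖x‖) ^ 2 := by
  rw [mul_pow]
  refine le_trans ?_ (mul_le_mul_of_nonneg_left (sum_sq_le_norm_sq x s) (sq_nonneg _))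
  rw [Finset.mul_sum]
  refine Finset.sum_le_sum fun i _ => ?_
  rw [← mul_pow]
  gcongr
  exact T.le_opNorm _

/-- A bounded operator acting on every component of an `ℓ²`-sum. -/
def lpMap (T : X →L[ℂ] Y) : lp (fun _ : ι => X) 2 →L[ℂ] lp (fun _ : ι => Y) 2 :=
  LinearMap.mkContinuous
    { toFun := fun x => ⟨fun i => T (x i), memlp_two_of_sum_le (sum_sq_map_le T x)⟩
      map_add' := fun x y => by ext i; simp; rfl
      map_smul' := fun a x => by ext i; simp } ‖T‖
    fun x => norm_le_of_sum_sq_le (by positivity) (sum_sq_map_le T x)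

@[simp] lemma lpMap_apply (T : X →L[ℂ] Y) (x : lp (fun _ : ι => X) 2) (i : ι) :
    lpMap T x i = T (x i) := rfl

end lpMap

section shift

variable {Γ : Type*} {r : ℕ}

lemma sum_sq_shift_le (σ : Γ ≃ Γ) (φ : lp (fun _ : Γ => ℂ) 2) (s : Finset Γ) :
    ∑ γ ∈ s, ‖φ (σ γ)‖ ^ 2 ≤ ‖φ‖ ^ 2 := by
  have := sum_sq_le_norm_sq φ (s.map σ.toEmbedding)
  simpa using this

/-- The operator `φ ↦ φ ∘ σ` on `ℓ²(Γ)`. -/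
def shift (σ : Γ ≃ Γ) : lp (fun _ : Γ => ℂ) 2 →L[ℂ] lp (fun _ : Γ => ℂ) 2 :=
  LinearMap.mkContinuous
    { toFun := fun φ => ⟨fun γ => φ (σ γ), memlp_two_of_sum_le (sum_sq_shift_le σ φ)⟩
      map_add' := fun x y => by ext i; simp; rfl
      map_smul' := fun a x => by ext i; simp } 1
    fun φ => by
      rw [one_mul]
      exact norm_le_of_sum_sq_le (by positivity) (sum_sq_shift_le σ φ)

@[simp] lemma shift_apply (σ : Γ ≃ Γ) (φ : lp (fun _ : Γ => ℂ) 2) (γ : Γ) :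
    shift σ φ γ = φ (σ γ) := rfl

lemma norm_shift_le (σ : Γ ≃ Γ) : ‖shift σ‖ ≤ 1 :=
  LinearMap.mkContinuous_norm_le _ zero_le_one _

lemma shift_refl : shift (Equiv.refl Γ) = 1 := by
  ext φ γ
  simp

lemma sum_sq_pull_le (σ : Fin r → Γ ≃ Γ) (φ : lp (fun _ : Γ => ℂ) 2) (s : Finset (Γ × Fin r)) :
    ∑ e ∈ s, ‖φ (σ e.2 e.1)‖ ^ 2 ≤ (Real.sqrt r * ‖φ‖) ^ 2 := by
  classical
  calc ∑ e ∈ s, ‖φ (σ e.2 e.1)‖ ^ 2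
      ≤ ∑ e ∈ s.image Prod.fst ×ˢ Finset.univ, ‖φ (σ e.2 e.1)‖ ^ 2 := by
        apply Finset.sum_le_sum_of_subset_of_nonneg
        · intro e he
          simpa using ⟨e.2, he⟩
        · intros; positivity
    _ = ∑ j, ∑ γ ∈ s.image Prod.fst, ‖φ (σ j γ)‖ ^ 2 := by
        rw [Finset.sum_product_right]
    _ ≤ ∑ _j : Fin r, ‖φ‖ ^ 2 := Finset.sum_le_sum fun j _ => sum_sq_shift_le (σ j) φ _
    _ = (Real.sqrt r * ‖φ‖) ^ 2 := by
        rw [mul_pow, Real.sq_sqrt (by positivity)]; simp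

/-- The pull-back `φ ↦ ((γ, j) ↦ φ (σ j γ))` of functions on the vertices to the edges. -/
def pull (σ : Fin r → Γ ≃ Γ) : lp (fun _ : Γ => ℂ) 2 →L[ℂ] lp (fun _ : Γ × Fin r => ℂ) 2 :=
  LinearMap.mkContinuous
    { toFun := fun φ => ⟨fun e => φ (σ e.2 e.1), memlp_two_of_sum_le (sum_sq_pull_le σ φ)⟩
      map_add' := fun x y => by ext i; simp; rfl
      map_smul' := fun a x => by ext i; simp } (Real.sqrt r)
    fun φ => norm_le_of_sum_sq_le (by positivity) (sum_sq_pull_le σ φ)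

@[simp] lemma pull_apply (σ : Fin r → Γ ≃ Γ) (φ : lp (fun _ : Γ => ℂ) 2) (e : Γ × Fin r) :
    pull σ φ e = φ (σ e.2 e.1) := rfl

/-- The sum over edges splits by direction, and in direction `j` the substitution `γ ↦ (σ j)⁻¹ γ`
moves both permutations to one side. -/
lemma inner_pull_pull (σ τ : Fin r → Γ ≃ Γ) (b φ : lp (fun _ : Γ => ℂ) 2) :
    inner ℂ (pull σ b) (pull τ φ) = ∑ j, inner ℂ b (shift ((σ j).symm.trans (τ j)) φ) := by
  rw [lp.inner_eq_tsum, ← (Equiv.prodComm (Fin r) Γ).tsum_eq, Summable.tsum_prod, tsum_fintype]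
  · refine Finset.sum_congr rfl fun j _ => ?_
    rw [lp.inner_eq_tsum, ← (σ j).symm.tsum_eq]
    simp
  · exact (Equiv.prodComm (Fin r) Γ).summable_iff.2
      (lp.summable_inner (pull σ b) (pull τ φ))

end shift

/-! ### Edgewise calculus on the metric graph. -/

section edges

variable {E : Type*}

/-- The edgewise Volterra operator. -/
def edgeInt : GraphL2 E →L[ℂ] GraphL2 E := lpMap volterra

/-- The edgewise mean value. -/
def edgeMean : GraphL2 E →L[ℂ] lp (fun _ : E => ℂ) 2 := lpMap (innerSL ℂ edgeOne)

/-- The element of `L²(X₀)` which is `x e • h` on the edge `e`. -/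
def edgeTensor (h : EdgeSpace) : lp (fun _ : E => ℂ) 2 →L[ℂ] GraphL2 E :=
  lpMap (ContinuousLinearMap.toSpanSingleton ℂ h)

lemma edgeInt_apply (D : GraphL2 E) (e : E) : edgeInt D e = volterra (D e) := rfl

lemma edgeMean_apply (D : GraphL2 E) (e : E) : edgeMean D e = inner ℂ edgeOne (D e) := rfl

lemma edgeTensor_apply (h : EdgeSpace) (x : lp (fun _ : E => ℂ) 2) (e : E) :
    edgeTensor h x e = x e • h := rfl

lemma edgeInt_edgeTensor (h : EdgeSpace) (x : lp (fun _ : E => ℂ) 2) :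
    edgeInt (edgeTensor h x) = edgeTensor (volterra h) x := by
  ext1; funext e
  simp only [edgeInt_apply, edgeTensor_apply, map_smul]

lemma edgeMean_edgeTensor (h : EdgeSpace) (x : lp (fun _ : E => ℂ) 2) :
    edgeMean (edgeTensor h x) = (inner ℂ edgeOne h : ℂ) • x := by
  ext1; funext e
  simp only [edgeMean_apply, edgeTensor_apply, inner_smul_right, lp.coeFn_smul, Pi.smul_apply,
    smul_eq_mul, mul_comm]

lemma edgeTensor_add (h k : EdgeSpace) (x : lp (fun _ : E => ℂ) 2) :
    edgeTensor (h + k) x = edgeTensor h x + edgeTensor k x := by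
  ext1; funext e
  simp only [edgeTensor_apply, lp.coeFn_add, Pi.add_apply, smul_add]

lemma edgeTensor_smul (a : ℂ) (h : EdgeSpace) (x : lp (fun _ : E => ℂ) 2) :
    edgeTensor (a • h) x = a • edgeTensor h x := by
  ext1; funext e
  simp only [edgeTensor_apply, lp.coeFn_smul, Pi.smul_apply, smul_comm a]

lemma inner_edgeTensor_one (x : lp (fun _ : E => ℂ) 2) (D : GraphL2 E) :
    inner ℂ (edgeTensor edgeOne x) D = inner ℂ x (edgeMean D) := by
  rw [lp.inner_eq_tsum, lp.inner_eq_tsum]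
  refine tsum_congr fun e => ?_
  rw [edgeTensor_apply, edgeMean_apply, inner_smul_left, RCLike.inner_apply, mul_comm]

lemma inner_edgeTensor_one_right (x : lp (fun _ : E => ℂ) 2) (D : GraphL2 E) :
    inner ℂ D (edgeTensor edgeOne x) = inner ℂ (edgeMean D) x := by
  rw [← inner_conj_symm, inner_edgeTensor_one, inner_conj_symm]

lemma inner_edgeInt_add (v w : GraphL2 E) :
    inner ℂ w (edgeInt v) + inner ℂ (edgeInt w) v = inner ℂ (edgeMean w) (edgeMean v) := by
  rw [lp.inner_eq_tsum, lp.inner_eq_tsum, lp.inner_eq_tsum,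
    ← (lp.summable_inner _ _).tsum_add (lp.summable_inner _ _)]
  refine tsum_congr fun e => ?_
  rw [edgeInt_apply, edgeInt_apply, inner_volterra_add, RCLike.inner_apply, edgeMean_apply,
    edgeMean_apply, inner_conj_symm, mul_comm]

/-- The inverse on one edge acts with the same norm bound on all edges, because they all have the
same length. -/
lemma exists_bound_one_add_edgeInt_sq (z : ℂ) :
    ∃ C : ℝ, 0 ≤ C ∧ ∀ x : GraphL2 E, ‖x‖ ≤ C * ‖x + z • edgeInt (edgeInt x)‖ := by
  obtain ⟨N, hN⟩ := isUnit_one_add_smul_volterra_sq z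
  refine ⟨‖lpMap (ι := E) (↑N⁻¹ : EdgeSpace →L[ℂ] EdgeSpace)‖, norm_nonneg _, fun x => ?_⟩
  have : lpMap (↑N⁻¹ : EdgeSpace →L[ℂ] EdgeSpace) (x + z • edgeInt (edgeInt x)) = x := by
    ext1; funext e
    have h1 := congrArg (fun T : EdgeSpace →L[ℂ] EdgeSpace => T (x e)) N.inv_mul
    simp only [hN] at h1
    rw [lpMap_apply]
    refine Eq.trans (congrArg _ ?_) h1
    simp [pow_two]
    rfl
  nth_rewrite 1 [← this]
  exact ContinuousLinearMap.le_opNorm _ _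

end edges


section edgeH1

variable {E : Type*}

/-- `u` is edgewise in `H¹`, with derivative `D`, initial values `x` and final values `y`. -/
def IsGraphH1 (u D : GraphL2 E) (x y : lp (fun _ : E => ℂ) 2) : Prop :=
  u = edgeTensor edgeOne x + edgeInt D ∧ y = x + edgeMean D

lemma IsGraphH1.add {u D u' D' : GraphL2 E} {x y x' y' : lp (fun _ : E => ℂ) 2}
    (h : IsGraphH1 u D x y) (h' : IsGraphH1 u' D' x' y') :
    IsGraphH1 (u + u') (D + D') (x + x') (y + y') := by
  obtain ⟨rfl, rfl⟩ := h
  obtain ⟨rfl, rfl⟩ := h'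
  constructor <;> simp only [map_add] <;> abel

lemma IsGraphH1.smul {u D : GraphL2 E} {x y : lp (fun _ : E => ℂ) 2} (a : ℂ)
    (h : IsGraphH1 u D x y) : IsGraphH1 (a • u) (a • D) (a • x) (a • y) := by
  obtain ⟨rfl, rfl⟩ := h
  constructor <;> simp only [map_smul, smul_add]

/-- Integration by parts. -/
lemma IsGraphH1.inner_add {u D u' D' : GraphL2 E} {x y x' y' : lp (fun _ : E => ℂ) 2}
    (h : IsGraphH1 u D x y) (h' : IsGraphH1 u' D' x' y') :
    inner ℂ u' D + inner ℂ D' u = inner ℂ y' y - inner ℂ x' x := by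
  obtain ⟨rfl, rfl⟩ := h
  obtain ⟨rfl, rfl⟩ := h'
  have := inner_edgeInt_add D D'
  simp only [inner_add_left, inner_add_right, inner_edgeTensor_one, inner_edgeTensor_one_right]
  linear_combination this

end edgeH1

/-! ### Fundamental solutions and the decoupled Dirichlet problem. -/

/-- `c` and `s` are the solutions on `[0,1]` of `-f'' = lam f` with initial data
`(f, f')(0) = (1, 0)` and `(0, 1)`, and `c1`, `s1` are their values at `1`. -/
structure IsFundamental (lam : ℝ) (c s : EdgeSpace) (c1 s1 : ℝ) : Prop where
  int_c : volterra c = s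
  int_s : c + (lam : ℂ) • volterra s = edgeOne
  mean_c : inner ℂ edgeOne c = (s1 : ℂ)
  mean_s : (lam : ℂ) * inner ℂ edgeOne s = 1 - (c1 : ℂ)
  det : c1 ^ 2 + lam * s1 ^ 2 = 1

section dirichlet

variable {E : Type*} {lam : ℝ} {c s : EdgeSpace} {c1 s1 : ℝ}

lemma IsFundamental.isGraphH1_s (h : IsFundamental lam c s c1 s1) (x : lp (fun _ : E => ℂ) 2) :
    IsGraphH1 (edgeTensor s x) (edgeTensor c x) 0 ((s1 : ℂ) • x) := by
  constructor
  · rw [edgeInt_edgeTensor, h.int_c, map_zero, zero_add]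
  · rw [edgeMean_edgeTensor, h.mean_c, zero_add]

lemma IsFundamental.isGraphH1_c (h : IsFundamental lam c s c1 s1) (x : lp (fun _ : E => ℂ) 2) :
    IsGraphH1 (edgeTensor c x) ((-lam : ℂ) • edgeTensor s x) x ((c1 : ℂ) • x) := by
  constructor
  · rw [map_smul, edgeInt_edgeTensor, ← edgeTensor_smul, ← edgeTensor_add, ← h.int_s]
    congr 2
    module
  · rw [map_smul, edgeMean_edgeTensor, smul_smul, neg_mul, h.mean_s]
    module

lemma inner_edgeOne_self : inner ℂ edgeOne edgeOne = (1 : ℂ) := by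
  have := inner_edgeOne_edgeOf (f := fun _ => 1) (g := fun x => x) continuous_const
    (fun x => hasDerivAt_id x)
  rw [sub_zero, Complex.ofReal_one] at this
  exact this

/-- Here `Z` is the derivative of `J Z`, and mean zero says that `J Z` vanishes at both ends of
every edge. The a priori bound holds because `s1 ≠ 0` means that `lam` is not a Dirichlet eigenvalue
of the unit interval. -/
lemma IsFundamental.dirichlet_bound (h : IsFundamental lam c s c1 s1) (hs1 : s1 ≠ 0) :
    ∃ C : ℝ, 0 ≤ C ∧ ∀ Z f : GraphL2 E, edgeMean Z = 0 →
      (∀ w : GraphL2 E, edgeMean w = 0 →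
        inner ℂ w Z - lam * inner ℂ (edgeInt w) (edgeInt Z) = inner ℂ (edgeInt w) f) →
      ‖edgeInt Z‖ ≤ C * ‖f‖ := by
  obtain ⟨C, hC, hCb⟩ := exists_bound_one_add_edgeInt_sq (E := E) (lam : ℂ)
  set J : GraphL2 E →L[ℂ] GraphL2 E := edgeInt with hJ
  set N : GraphL2 E →L[ℂ] lp (fun _ : E => ℂ) 2 := edgeMean with hN
  set I : lp (fun _ : E => ℂ) 2 →L[ℂ] GraphL2 E := edgeTensor s with hI
  have hs1' : (s1 : ℂ) ≠ 0 := by exact_mod_cast hs1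
  refine ⟨C * (‖J‖ * ‖J‖) +
    ‖I‖ * (|s1|⁻¹ * (‖N‖ * (‖J‖ * (|lam| * (C * (‖J‖ * ‖J‖)) + 1)))), by positivity, ?_⟩
  intro Z f hZ hw
  set k := (lam : ℂ) • J Z + f with hk
  set y := Z + J k with hy
  -- Du Bois-Reymond: a function orthogonal to everything of mean zero is constant on each edge. The
  -- constant `α` is then the initial slope of `J Z`.
  have hwy : ∀ w, N w = 0 → inner ℂ w y = 0 := by
    intro w h0
    have h1 := hw w h0
    have h2 := inner_edgeInt_add k w
    rw [← hN, h0, inner_zero_left] at h2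
    rw [hy, inner_add_right]
    rw [hk, inner_add_right, inner_smul_right] at h2
    linear_combination h1 + h2
  have hNN : ∀ x, N (edgeTensor edgeOne x) = x := by
    intro x
    rw [hN, edgeMean_edgeTensor, inner_edgeOne_self, one_smul]
  have hyα : y = edgeTensor edgeOne (N y) := by
    have h0 : N (y - edgeTensor edgeOne (N y)) = 0 := by rw [map_sub, hNN, sub_self]
    have h1 := hwy _ h0
    have h2 := inner_edgeTensor_one_right (N y) (y - edgeTensor edgeOne (N y))
    rw [← hN, h0, inner_zero_left] at h2
    rw [← sub_eq_zero, ← inner_self_eq_zero (𝕜 := ℂ), inner_sub_right, h1, h2, sub_zero]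
  set α := N y with hα
  have hZα : Z = edgeTensor edgeOne α - J k := by rw [← hyα, hy, add_sub_cancel_right]
  have hIα : I α + (lam : ℂ) • J (J (I α)) = J (edgeTensor edgeOne α) := by
    rw [hI, hJ, edgeInt_edgeTensor, edgeInt_edgeTensor, edgeInt_edgeTensor, ← edgeTensor_smul,
      ← edgeTensor_add, ← h.int_s, map_add, h.int_c, map_smul]
  -- Removing the solution with initial slope `α` leaves zero initial data, hence a Volterra
  -- equation with right side `-J² f`.
  set ζ := J Z - I α with hζ
  have hJZ : J Z = ζ + I α := by rw [hζ, sub_add_cancel]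
  have hζeq : ζ + (lam : ℂ) • J (J ζ) = -J (J f) := by
    have h1 : J Z = J (edgeTensor edgeOne α) - J (J k) := by
      nth_rewrite 1 [hZα]
      rw [map_sub]
    have h2 : J (J k) = (lam : ℂ) • J (J (J Z)) + J (J f) := by
      rw [hk]; simp only [map_add, map_smul]
    rw [h2, ← hIα] at h1
    have h3 : J (J (J Z)) = J (J ζ) + J (J (I α)) := by rw [hJZ, map_add, map_add]
    rw [h3, hJZ, smul_add] at h1
    have h4 := sub_eq_zero.2 h1
    rw [← sub_eq_zero, ← h4]
    abel
  have hζb : ‖ζ‖ ≤ C * (‖J‖ * ‖J‖) * ‖f‖ := by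
    refine (hCb ζ).trans ?_
    rw [hζeq, norm_neg, mul_assoc]
    gcongr
    rw [mul_assoc]
    exact (J.le_opNorm _).trans (by gcongr; exact J.le_opNorm _)
  -- The Dirichlet condition at the far end determines `α`; this is where `s1` has to be divided
  -- out.
  have hα1 : (s1 : ℂ) • α = N (J ((lam : ℂ) • ζ + f)) := by
    have h1 : N Z = α - N (J k) := by
      nth_rewrite 1 [hZα]
      rw [map_sub, hNN]
    have h2 : N (J k) = N (J ((lam : ℂ) • ζ + f)) + (lam : ℂ) • N (J (I α)) := by
      rw [hk, hJZ]; simp only [map_add, map_smul, smul_add]; abel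
    have h3 : (lam : ℂ) • N (J (I α)) = α - (s1 : ℂ) • α := by
      rw [hJ, hI, hN, edgeInt_edgeTensor, edgeMean_edgeTensor, smul_smul, ← inner_smul_right,
        show (lam : ℂ) • volterra s = edgeOne - c by rw [← h.int_s]; abel, inner_sub_right,
        h.mean_c, inner_edgeOne_self, sub_smul, one_smul]
    rw [hZ, h2, h3] at h1
    have h4 : (s1 : ℂ) • α - N (J ((lam : ℂ) • ζ + f)) =
        α - (N (J ((lam : ℂ) • ζ + f)) + (α - (s1 : ℂ) • α)) := by abel
    rw [← h1] at h4
    exact sub_eq_zero.1 h4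
  have hαb : ‖α‖ ≤ |s1|⁻¹ * (‖N‖ * (‖J‖ * ((|lam| * (C * (‖J‖ * ‖J‖)) + 1) * ‖f‖))) := by
    have h1 : α = (s1 : ℂ)⁻¹ • N (J ((lam : ℂ) • ζ + f)) := by
      rw [← hα1, smul_smul, inv_mul_cancel₀ hs1', one_smul]
    rw [h1, norm_smul, norm_inv, Complex.norm_real, Real.norm_eq_abs]
    refine mul_le_mul_of_nonneg_left ?_ (by positivity)
    refine (N.le_opNorm _).trans (mul_le_mul_of_nonneg_left ?_ (norm_nonneg _))
    refine (J.le_opNorm _).trans (mul_le_mul_of_nonneg_left ?_ (norm_nonneg _))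
    refine (norm_add_le _ _).trans ?_
    rw [norm_smul, Complex.norm_real, Real.norm_eq_abs, add_mul, one_mul, mul_assoc]
    gcongr
  calc ‖J Z‖ ≤ ‖ζ‖ + ‖I‖ * ‖α‖ := by
        rw [hJZ]
        exact (norm_add_le _ _).trans (by gcongr; exact I.le_opNorm _)
    _ ≤ C * (‖J‖ * ‖J‖) * ‖f‖ +
        ‖I‖ * (|s1|⁻¹ * (‖N‖ * (‖J‖ * ((|lam| * (C * (‖J‖ * ‖J‖)) + 1) * ‖f‖)))) := by gcongr
    _ = _ := by ring

end dirichlet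

/-! ### Vertex values on the Cayley graph and Green's formula. -/

section cayley

variable {Γ : Type*} {r : ℕ}

/-- The values at the initial vertices of the edges. -/
def pullSrc : lp (fun _ : Γ => ℂ) 2 →L[ℂ] lp (fun _ : Γ × Fin r => ℂ) 2 :=
  pull fun _ => Equiv.refl Γ

lemma inner_src_src (b φ : lp (fun _ : Γ => ℂ) 2) :
    inner ℂ (pullSrc (r := r) b) (pullSrc φ) = r * inner ℂ b φ := by
  rw [pullSrc, inner_pull_pull]
  simp only [Equiv.symm_trans_self, shift_refl]
  simp

variable [AddCommGroup Γ]

/-- The values at the final vertices of the edges. -/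
def pullTgt (g : Fin r → Γ) : lp (fun _ : Γ => ℂ) 2 →L[ℂ] lp (fun _ : Γ × Fin r => ℂ) 2 :=
  pull fun j => Equiv.addRight (g j)

/-- Translation by `a` on `ℓ²(Γ)`. -/
def translate (a : Γ) : lp (fun _ : Γ => ℂ) 2 →L[ℂ] lp (fun _ : Γ => ℂ) 2 :=
  shift (Equiv.addRight a)

/-- The adjacency operator of the Cayley graph. -/
def adjacency (g : Fin r → Γ) : lp (fun _ : Γ => ℂ) 2 →L[ℂ] lp (fun _ : Γ => ℂ) 2 :=
  ∑ j, (translate (g j) + translate (-g j))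

lemma translate_neg (a : Γ) : translate (-a) = shift (Equiv.addRight a).symm := by
  ext φ γ
  simp [translate]

lemma inner_tgt_tgt (g : Fin r → Γ) (b φ : lp (fun _ : Γ => ℂ) 2) :
    inner ℂ (pullTgt g b) (pullTgt g φ) = r * inner ℂ b φ := by
  rw [pullTgt, inner_pull_pull]
  simp only [Equiv.symm_trans_self, shift_refl]
  simp

lemma inner_adjacency (g : Fin r → Γ) (b φ : lp (fun _ : Γ => ℂ) 2) :
    inner ℂ (pullSrc b) (pullTgt g φ) + inner ℂ (pullTgt g b) (pullSrc φ) =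
      inner ℂ b (adjacency g φ) := by
  rw [pullTgt, pullSrc, inner_pull_pull, inner_pull_pull, adjacency, ← Finset.sum_add_distrib,
    sum_apply, inner_sum]
  refine Finset.sum_congr rfl fun j _ => ?_
  rw [add_apply, inner_add_right, translate_neg]
  rfl

/-- The rescaled vertex component `φ = vol^(-1/2) ψ` is the common value of `u` at the vertices. -/
lemma inFormDomain_iff (g : Fin r → Γ) {vol : ℝ} (hvol : 0 < vol)
    (U : ExtSpace (Γ × Fin r) Γ) (D : GraphL2 (Γ × Fin r)) :
    InFormDomain (fun e : Γ × Fin r => e.1) (fun e : Γ × Fin r => e.1 + g e.2) vol U D ↔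
      IsGraphH1 U.fst D (pullSrc ((Real.sqrt vol : ℂ)⁻¹ • U.snd))
        (pullTgt g ((Real.sqrt vol : ℂ)⁻¹ • U.snd)) := by
  have h0 : (Real.sqrt vol : ℂ) ≠ 0 := by exact_mod_cast (Real.sqrt_pos.2 hvol).ne'
  have hab : ∀ a z : ℂ, (Real.sqrt vol : ℂ) * a = z ↔ a = (Real.sqrt vol : ℂ)⁻¹ * z :=
    fun a z => (eq_inv_mul_iff_mul_eq₀ h0).symm
  constructor
  · intro h
    constructor
    · ext1; funext e
      obtain ⟨a, b, h1, h2, h3⟩ := h e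
      rw [isEdgeH1_iff, hab _ _ |>.1 h2] at h1
      exact h1.1
    · ext1; funext e
      obtain ⟨a, b, h1, h2, h3⟩ := h e
      rw [isEdgeH1_iff, hab _ _ |>.1 h2, hab _ _ |>.1 h3] at h1
      exact h1.2
  · rintro ⟨h1, h2⟩ e
    refine ⟨_, _, (isEdgeH1_iff _ _ _ _).2 ⟨?_, ?_⟩, (hab _ _).2 rfl, (hab _ _).2 rfl⟩
    · exact congrArg (fun w : GraphL2 (Γ × Fin r) => w e) h1
    · exact congrArg (fun w : lp (fun _ : Γ × Fin r => ℂ) 2 => w e) h2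

variable {lam : ℝ} {c s : EdgeSpace} {c1 s1 : ℝ}

/-- The function on the graph which solves `-u'' = lam u` and has the vertex values `s1 • b`. -/
def lift (g : Fin r → Γ) (c s : EdgeSpace) (c1 s1 : ℝ) :
    lp (fun _ : Γ => ℂ) 2 →L[ℂ] GraphL2 (Γ × Fin r) :=
  (s1 : ℂ) • (edgeTensor c ∘L pullSrc) + (-c1 : ℂ) • (edgeTensor s ∘L pullSrc) +
    edgeTensor s ∘L pullTgt g

/-- The derivative of `lift`. -/
def liftDeriv (g : Fin r → Γ) (lam : ℝ) (c s : EdgeSpace) (c1 s1 : ℝ) :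
    lp (fun _ : Γ => ℂ) 2 →L[ℂ] GraphL2 (Γ × Fin r) :=
  (s1 : ℂ) • ((-lam : ℂ) • (edgeTensor s ∘L pullSrc)) + (-c1 : ℂ) • (edgeTensor c ∘L pullSrc) +
    edgeTensor c ∘L pullTgt g

lemma lift_apply (g : Fin r → Γ) (b : lp (fun _ : Γ => ℂ) 2) :
    lift g c s c1 s1 b = (s1 : ℂ) • edgeTensor c (pullSrc b) +
      (-c1 : ℂ) • edgeTensor s (pullSrc b) + edgeTensor s (pullTgt g b) := rfl

lemma liftDeriv_apply (g : Fin r → Γ) (b : lp (fun _ : Γ => ℂ) 2) :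
    liftDeriv g lam c s c1 s1 b = (s1 : ℂ) • (-lam : ℂ) • edgeTensor s (pullSrc b) +
      (-c1 : ℂ) • edgeTensor c (pullSrc b) + edgeTensor c (pullTgt g b) := rfl

lemma IsFundamental.isGraphH1_lift (h : IsFundamental lam c s c1 s1) (g : Fin r → Γ)
    (b : lp (fun _ : Γ => ℂ) 2) :
    IsGraphH1 (lift g c s c1 s1 b) (liftDeriv g lam c s c1 s1 b)
      ((s1 : ℂ) • pullSrc b) ((s1 : ℂ) • pullTgt g b) := by
  have := (((h.isGraphH1_c (pullSrc b)).smul s1).add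
    ((h.isGraphH1_s (pullSrc b)).smul (-c1))).add (h.isGraphH1_s (pullTgt g b))
  rw [lift_apply, liftDeriv_apply]
  convert this using 1 <;> module

/-- The boundary values here are the slopes that enter the vertex fluxes. The slope at the far end
simplifies by the Wronskian identity `c1² + lam s1² = 1`. -/
lemma IsFundamental.isGraphH1_liftDeriv (h : IsFundamental lam c s c1 s1) (g : Fin r → Γ)
    (b : lp (fun _ : Γ => ℂ) 2) :
    IsGraphH1 (liftDeriv g lam c s c1 s1 b) ((-lam : ℂ) • lift g c s c1 s1 b)
      (pullTgt g b - (c1 : ℂ) • pullSrc b) ((c1 : ℂ) • pullTgt g b - pullSrc b) := by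
  have := ((((h.isGraphH1_s (pullSrc b)).smul (-lam)).smul s1).add
    ((h.isGraphH1_c (pullSrc b)).smul (-c1))).add (h.isGraphH1_c (pullTgt g b))
  have hd : (c1 : ℂ) ^ 2 + lam * s1 ^ 2 = 1 := by exact_mod_cast h.det
  rw [lift_apply, liftDeriv_apply]
  convert this using 1
  · module
  · module
  · calc (c1 : ℂ) • pullTgt g b - pullSrc b
        = (c1 : ℂ) • pullTgt g b - ((c1 : ℂ) ^ 2 + lam * s1 ^ 2) • pullSrc b := by
          rw [hd, one_smul]
      _ = _ := by module

/-- Green's formula against `lift b`. -/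
lemma IsFundamental.green (h : IsFundamental lam c s c1 s1) (g : Fin r → Γ)
    (b φ : lp (fun _ : Γ => ℂ) 2) {u D : GraphL2 (Γ × Fin r)}
    (hu : IsGraphH1 u D (pullSrc φ) (pullTgt g φ)) :
    inner ℂ D (liftDeriv g lam c s c1 s1 b) - lam * inner ℂ u (lift g c s c1 s1 b) =
      inner ℂ φ (((2 * r * c1 : ℂ) • b - adjacency g b)) := by
  have h1 := (h.isGraphH1_liftDeriv g b).inner_add hu
  have h2 := inner_adjacency g φ b
  have h3 := inner_src_src (r := r) φ b
  have h4 := inner_tgt_tgt g φ b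
  simp only [inner_sub_right, inner_smul_right] at h1 ⊢
  linear_combination h1 - h2 + c1 * h3 + c1 * h4

end cayley


/-! ### Resolvents of operators given by closed forms, and two spectral criteria. -/

lemma _root_.IsSelfAdjoint.one_sub_real_smul {H : Type*} [NormedAddCommGroup H]
    [InnerProductSpace ℂ H] [CompleteSpace H] {T : H →L[ℂ] H} (hT : IsSelfAdjoint T) (a : ℝ) :
    IsSelfAdjoint (1 - (a : ℂ) • T) :=
  (IsSelfAdjoint.one _).sub (IsSelfAdjoint.smul (Complex.conj_ofReal a) hT)

/-- Bounded below gives injectivity and closed range; self-adjointness identifies the orthogonal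
complement of the range with the kernel. -/
lemma isUnit_of_isSelfAdjoint_of_bound {H : Type*} [NormedAddCommGroup H] [InnerProductSpace ℂ H]
    [CompleteSpace H] {T : H →L[ℂ] H} (hT : IsSelfAdjoint T) {C : ℝ}
    (hC : ∀ x, ‖x‖ ≤ C * ‖T x‖) : IsUnit T := by
  have hanti : AntilipschitzWith C.toNNReal T := by
    refine T.antilipschitz_of_bound fun x => (hC x).trans ?_
    gcongr
    exact Real.le_coe_toNNReal C
  have hclosed : IsClosed (Set.range T) := hanti.isClosed_range T.uniformContinuous
  have hinj : Function.Injective T := hanti.injective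
  have hsurj : LinearMap.range (T : H →ₗ[ℂ] H) = ⊤ := by
    have : CompleteSpace (LinearMap.range (T : H →ₗ[ℂ] H)) := by
      apply IsClosed.completeSpace_coe (hs := ?_)
      rw [LinearMap.coe_range]
      exact hclosed
    rw [← Submodule.orthogonal_eq_bot_iff, Submodule.eq_bot_iff]
    intro x hx
    rw [Submodule.mem_orthogonal] at hx
    apply hinj
    rw [map_zero, ← inner_self_eq_zero (𝕜 := ℂ)]
    have h1 := hx (T (T x)) ⟨T x, rfl⟩
    rw [← ContinuousLinearMap.adjoint_inner_right, hT.adjoint_eq] at h1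
    exact h1
  have hbij : Function.Bijective T := ⟨hinj, LinearMap.range_eq_top.1 hsurj⟩
  exact ContinuousLinearMap.isUnit_iff_bijective.2 hbij

/-- If `M` is the graph of a closed operator `U ↦ D`, then the operator associated with the form
`‖D‖²` is of the form `G⁻¹ - 1` for a bounded self-adjoint operator `G`. -/
lemma exists_inverse_one_add_of_isClosed {X Y : Type*} [NormedAddCommGroup X]
    [InnerProductSpace ℂ X] [CompleteSpace X] [NormedAddCommGroup Y] [InnerProductSpace ℂ Y]
    [CompleteSpace Y] {M : Submodule ℂ (WithLp 2 (X × Y))}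
    (hM : IsClosed (M : Set (WithLp 2 (X × Y)))) :
    ∃ G : X →L[ℂ] X, IsSelfAdjoint G ∧ ∀ U W, (∃ D, WithLp.toLp 2 (U, D) ∈ M ∧
      ∀ p ∈ M, inner ℂ p.snd D = inner ℂ p.fst W) ↔ U = G (W + U) := by
  have : CompleteSpace M := hM.completeSpace_coe
  -- `M` carries the graph norm, that is, the norm of the form plus one. So `π* F` is the weak
  -- solution of `(Q + 1) U = F`, and `G = π π*` is visibly self-adjoint.
  let π : M →L[ℂ] X := (WithLp.fstL 2 ℂ X Y) ∘L M.subtypeL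
  let A : X →L[ℂ] M := ContinuousLinearMap.adjoint π
  have hadj : ∀ (p : M) (F : X), inner ℂ p (A F) = inner ℂ p.1.fst F :=
    fun p F => ContinuousLinearMap.adjoint_inner_right π p F
  refine ⟨π ∘L A, ?_, fun U W => ⟨?_, fun h => ?_⟩⟩
  · rw [ContinuousLinearMap.isSelfAdjoint_iff', ContinuousLinearMap.adjoint_comp,
      ContinuousLinearMap.adjoint_adjoint]
  · rintro ⟨D, hm, h⟩
    have : (⟨_, hm⟩ : M) = A (W + U) := by
      refine ext_inner_left ℂ fun p => ?_
      rw [hadj, inner_add_right, ← h _ p.2, Submodule.coe_inner, WithLp.prod_inner_apply]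
      exact add_comm _ _
    rw [ContinuousLinearMap.comp_apply, ← this]
    rfl
  · have hU : (A (W + U)).1.fst = U := h.symm
    refine ⟨(A (W + U)).1.snd, ?_, fun p hp => ?_⟩
    · have h2 : WithLp.toLp 2 (U, (A (W + U)).1.snd) = (A (W + U)).1 := by
        nth_rewrite 1 [← hU]
        rfl
      rw [h2]
      exact (A (W + U)).2
    · have h1 := hadj ⟨p, hp⟩ (W + U)
      rw [Submodule.coe_inner, WithLp.prod_inner_apply, inner_add_right] at h1
      change inner ℂ p.fst (A (W + U)).1.fst + inner ℂ p.snd (A (W + U)).1.snd =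
        inner ℂ p.fst W + inner ℂ p.fst U at h1
      rw [hU] at h1
      linear_combination h1

section cayley

variable {Γ : Type*} [AddCommGroup Γ] {r : ℕ}

/-- The form domain, as the closed subspace of all pairs of an element and its derivative. -/
def formSpace (g : Fin r → Γ) (vol : ℝ) :
    Submodule ℂ (WithLp 2 (ExtSpace (Γ × Fin r) Γ × GraphL2 (Γ × Fin r))) where
  carrier := {p | IsGraphH1 p.fst.fst p.snd (pullSrc ((Real.sqrt vol : ℂ)⁻¹ • p.fst.snd))
    (pullTgt g ((Real.sqrt vol : ℂ)⁻¹ • p.fst.snd))}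
  add_mem' := by
    intro p q hp hq
    have := IsGraphH1.add hp hq
    rw [← map_add, ← map_add, ← smul_add] at this
    exact this
  zero_mem' := by
    constructor <;> simp
  smul_mem' := by
    intro a p hp
    have := IsGraphH1.smul a hp
    rw [← map_smul, ← map_smul, smul_comm] at this
    exact this

lemma isClosed_formSpace (g : Fin r → Γ) (vol : ℝ) :
    IsClosed (formSpace g vol : Set (WithLp 2 (ExtSpace (Γ × Fin r) Γ × GraphL2 (Γ × Fin r)))) := by
  have h1 : Continuous fun p : WithLp 2 (ExtSpace (Γ × Fin r) Γ × GraphL2 (Γ × Fin r)) =>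
      p.fst := WithLp.continuous_fst _ _ _
  have h2 : Continuous fun p : WithLp 2 (ExtSpace (Γ × Fin r) Γ × GraphL2 (Γ × Fin r)) =>
      p.snd := WithLp.continuous_snd _ _ _
  have h11 : Continuous fun p : WithLp 2 (ExtSpace (Γ × Fin r) Γ × GraphL2 (Γ × Fin r)) =>
      p.fst.fst := (WithLp.continuous_fst _ _ _).comp h1
  have h12 : Continuous fun p : WithLp 2 (ExtSpace (Γ × Fin r) Γ × GraphL2 (Γ × Fin r)) =>
      p.fst.snd := (WithLp.continuous_snd _ _ _).comp h1
  apply IsClosed.and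
  · exact isClosed_eq h11 (by fun_prop)
  · exact isClosed_eq (by fun_prop) (by fun_prop)

lemma mem_formSpace_iff (g : Fin r → Γ) {vol : ℝ} (hvol : 0 < vol)
    (p : WithLp 2 (ExtSpace (Γ × Fin r) Γ × GraphL2 (Γ × Fin r))) :
    p ∈ formSpace g vol ↔ InFormDomain (fun e : Γ × Fin r => e.1)
      (fun e : Γ × Fin r => e.1 + g e.2) vol p.fst p.snd :=
  (inFormDomain_iff g hvol _ _).symm

/-- The operator `(Q + 1)⁻¹`. -/
lemma exists_inverse_one_add (g : Fin r → Γ) {vol : ℝ} (hvol : 0 < vol) :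
    ∃ G : ExtSpace (Γ × Fin r) Γ →L[ℂ] ExtSpace (Γ × Fin r) Γ, IsSelfAdjoint G ∧
      ∀ U W, IsLimitOp (fun e : Γ × Fin r => e.1) (fun e : Γ × Fin r => e.1 + g e.2) vol U W ↔
        U = G (W + U) := by
  obtain ⟨G, hG, h⟩ := exists_inverse_one_add_of_isClosed (isClosed_formSpace g vol)
  refine ⟨G, hG, fun U W => ?_⟩
  rw [← h]
  refine exists_congr fun D => and_congr (mem_formSpace_iff g hvol (WithLp.toLp 2 (U, D))).symm ?_
  constructor
  · intro h p hp
    exact h _ _ ((mem_formSpace_iff g hvol _).1 hp)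
  · intro h U' D' h'
    exact h (WithLp.toLp 2 (U', D')) ((mem_formSpace_iff g hvol _).2 h')

/-- With `G = (Q + 1)⁻¹` one has `Q - lam = (1 - (lam + 1) G) G⁻¹`. A lower bound for `Q - lam`
passes to the bounded self-adjoint operator `1 - (lam + 1) G`, whose inverse composed with `G` is
the resolvent. -/
lemma not_mem_cayleySpectrum_of_bound (g : Fin r → Γ) {vol : ℝ} (hvol : 0 < vol) {lam C : ℝ}
    (h : ∀ U W, IsLimitOp (fun e : Γ × Fin r => e.1) (fun e : Γ × Fin r => e.1 + g e.2) vol U W →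
      ‖U‖ ≤ C * ‖W - (lam : ℂ) • U‖) : lam ∉ cayleySpectrum g vol := by
  obtain ⟨G, hG, hQ⟩ := exists_inverse_one_add g hvol
  have hsa : IsSelfAdjoint (1 - ((lam + 1 : ℝ) : ℂ) • G) := hG.one_sub_real_smul (lam + 1)
  have hb : ∀ H, ‖H‖ ≤ (1 + |lam + 1| * C) * ‖(1 - ((lam + 1 : ℝ) : ℂ) • G) H‖ := by
    intro H
    have h1 := h (G H) (H - G H) ((hQ _ _).2 (by rw [sub_add_cancel]))
    have h2 : H - G H - (lam : ℂ) • G H = (1 - ((lam + 1 : ℝ) : ℂ) • G) H := by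
      change _ = H - ((lam + 1 : ℝ) : ℂ) • G H
      push_cast
      module
    rw [h2] at h1
    calc ‖H‖ = ‖(1 - ((lam + 1 : ℝ) : ℂ) • G) H + ((lam + 1 : ℝ) : ℂ) • G H‖ := by
          congr 1
          change H = H - ((lam + 1 : ℝ) : ℂ) • G H + ((lam + 1 : ℝ) : ℂ) • G H
          abel
      _ ≤ ‖(1 - ((lam + 1 : ℝ) : ℂ) • G) H‖ +
          |lam + 1| * (C * ‖(1 - ((lam + 1 : ℝ) : ℂ) • G) H‖) := by
          refine (norm_add_le _ _).trans ?_
          rw [norm_smul, Complex.norm_real, Real.norm_eq_abs]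
          gcongr
      _ = _ := by ring
  obtain ⟨N, hN⟩ := isUnit_of_isSelfAdjoint_of_bound hsa hb
  have e1 : ∀ x, (N : ExtSpace (Γ × Fin r) Γ →L[ℂ] ExtSpace (Γ × Fin r) Γ) ((↑N⁻¹ :
      ExtSpace (Γ × Fin r) Γ →L[ℂ] ExtSpace (Γ × Fin r) Γ) x) = x := fun x =>
    congrArg (fun T : ExtSpace (Γ × Fin r) Γ →L[ℂ] ExtSpace (Γ × Fin r) Γ => T x) N.mul_inv
  have e2 : ∀ x, (↑N⁻¹ : ExtSpace (Γ × Fin r) Γ →L[ℂ] ExtSpace (Γ × Fin r) Γ) ((N :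
      ExtSpace (Γ × Fin r) Γ →L[ℂ] ExtSpace (Γ × Fin r) Γ) x) = x := fun x =>
    congrArg (fun T : ExtSpace (Γ × Fin r) Γ →L[ℂ] ExtSpace (Γ × Fin r) Γ => T x) N.inv_mul
  have hNa : ∀ x, (N : ExtSpace (Γ × Fin r) Γ →L[ℂ] ExtSpace (Γ × Fin r) Γ) x =
      x - ((lam + 1 : ℝ) : ℂ) • G x := fun x => by rw [hN]; rfl
  intro hmem
  apply hmem
  refine ⟨(↑N⁻¹ : ExtSpace (Γ × Fin r) Γ →L[ℂ] ExtSpace (Γ × Fin r) Γ) ∘L G, fun U F => ?_⟩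
  have key : U = G (F + (lam : ℂ) • U + U) ↔
      (N : ExtSpace (Γ × Fin r) Γ →L[ℂ] ExtSpace (Γ × Fin r) Γ) U = G F := by
    rw [hNa, sub_eq_iff_eq_add, map_add, map_add, map_smul]
    refine Eq.congr rfl ?_
    push_cast
    module
  rw [ContinuousLinearMap.comp_apply]
  constructor
  · rintro ⟨W, hW, rfl⟩
    have h1 := (hQ _ _).1 hW
    rw [← key.1 (by rwa [sub_add_cancel]), e2]
  · rintro hU
    refine ⟨F + (lam : ℂ) • U, (hQ _ _).2 (key.2 ?_), add_sub_cancel_right _ _⟩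
    rw [hU, e1]

lemma mem_cayleySpectrum_of_approx (g : Fin r → Γ) {vol : ℝ} {lam : ℝ}
    (h : ∀ η : ℝ, 0 < η → ∃ U W, IsLimitOp (fun e : Γ × Fin r => e.1)
      (fun e : Γ × Fin r => e.1 + g e.2) vol U W ∧ U ≠ 0 ∧
      ‖W - (lam : ℂ) • U‖ ≤ η * ‖U‖) : lam ∈ cayleySpectrum g vol := by
  rintro ⟨R, hR⟩
  -- This tolerance forces `‖U‖ ≤ ‖U‖ / 2`.
  obtain ⟨U, W, hQ, hU, hle⟩ := h (1 / (2 * (‖R‖ + 1))) (by positivity)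
  have h1 := (hR U _).1 ⟨W, hQ, rfl⟩
  have h2 : ‖U‖ ≤ ‖R‖ * ‖W - (lam : ℂ) • U‖ := by
    nth_rewrite 1 [h1]
    exact R.le_opNorm _
  have hpos : 0 < ‖U‖ := norm_pos_iff.2 hU
  have h3 : ‖U‖ ≤ (‖R‖ + 1) * (1 / (2 * (‖R‖ + 1)) * ‖U‖) :=
    h2.trans (by gcongr; linarith)
  have h4 : (‖R‖ + 1) * (1 / (2 * (‖R‖ + 1)) * ‖U‖) = ‖U‖ / 2 := by
    have := norm_nonneg R
    field_simp
  linarith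

end cayley


/-! ### Reduction of the spectrum of `Q₀` to the discrete graph. -/

lemma norm_edgeTensor {E : Type*} (h : EdgeSpace) (x : lp (fun _ : E => ℂ) 2) :
    ‖edgeTensor h x‖ = ‖h‖ * ‖x‖ := by
  have h1 : inner ℂ (edgeTensor h x) (edgeTensor h x) = inner ℂ h h * inner ℂ x x := by
    rw [lp.inner_eq_tsum, lp.inner_eq_tsum, ← tsum_mul_left]
    refine tsum_congr fun e => ?_
    rw [edgeTensor_apply, inner_smul_left, inner_smul_right, RCLike.inner_apply]
    ring
  rw [inner_self_eq_norm_sq_to_K, inner_self_eq_norm_sq_to_K, inner_self_eq_norm_sq_to_K,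
    ← mul_pow] at h1
  have h2 : ‖edgeTensor h x‖ ^ 2 = (‖h‖ * ‖x‖) ^ 2 := by exact_mod_cast h1
  exact (pow_left_inj₀ (norm_nonneg _) (by positivity) two_ne_zero).1 h2

lemma norm_toLp_le {X Y : Type*} [NormedAddCommGroup X] [NormedAddCommGroup Y]
    (U : WithLp 2 (X × Y)) : ‖U‖ ≤ ‖U.fst‖ + ‖U.snd‖ := by
  have := WithLp.prod_norm_sq_eq_of_L2 U
  refine abs_le_of_sq_le_sq' ?_ (by positivity) |>.2
  nlinarith [norm_nonneg U.fst, norm_nonneg U.snd]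

section cayley

variable {Γ : Type*} [AddCommGroup Γ] {r : ℕ} {lam : ℝ} {c s : EdgeSpace} {c1 s1 : ℝ}

lemma adjacency_symm (g : Fin r → Γ) (b φ : lp (fun _ : Γ => ℂ) 2) :
    inner ℂ (adjacency g b) φ = inner ℂ b (adjacency g φ) := by
  rw [← inner_conj_symm, ← inner_adjacency, ← inner_adjacency, map_add, inner_conj_symm,
    inner_conj_symm, add_comm]

/-- The vertex values are controlled by the discrete operator; what remains of `u` after subtracting
the solution with these vertex values vanishes at all vertices and is controlled by
`IsFundamental.dirichlet_bound`. -/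
lemma IsFundamental.not_mem_cayleySpectrum (h : IsFundamental lam c s c1 s1) (hs1 : s1 ≠ 0)
    (g : Fin r → Γ) {vol : ℝ} (hvol : 0 < vol) {K : ℝ} (hK0 : 0 ≤ K)
    (hK : ∀ φ : lp (fun _ : Γ => ℂ) 2,
      ‖φ‖ ≤ K * ‖((2 * r * c1 - lam * vol * s1 : ℝ) : ℂ) • φ - adjacency g φ‖) :
    lam ∉ cayleySpectrum g vol := by
  obtain ⟨C, hC, hCb⟩ := h.dirichlet_bound (E := Γ × Fin r) hs1
  have hv : 0 < Real.sqrt vol := Real.sqrt_pos.2 hvol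
  have hvv : Real.sqrt vol * Real.sqrt vol = vol := Real.mul_self_sqrt hvol.le
  set v := Real.sqrt vol with hvdef
  have hv0 : (v : ℂ) ≠ 0 := by exact_mod_cast hv.ne'
  have hvvc : (v : ℂ) * v = vol := by exact_mod_cast hvv
  set Λ := lift g c s c1 s1 with hΛ
  set B := K * (‖Λ‖ + v * |s1|) with hB
  have hB0 : 0 ≤ B := by positivity
  apply not_mem_cayleySpectrum_of_bound g hvol (C := C + |s1|⁻¹ * (‖Λ‖ * B) + v * B)
  rintro U W ⟨D, hD, hW⟩
  rw [inFormDomain_iff g hvol, ← hvdef] at hD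
  set φ := (v : ℂ)⁻¹ • U.snd with hφ
  have hψ : U.snd = (v : ℂ) • φ := by rw [hφ, smul_smul, mul_inv_cancel₀ hv0, one_smul]
  set F := W - (lam : ℂ) • U with hF
  have hW1 : W.fst = F.fst + (lam : ℂ) • U.fst := by
    rw [hF, WithLp.sub_fst, WithLp.smul_fst, sub_add_cancel]
  have hW2 : W.snd = F.snd + (lam : ℂ) • (v : ℂ) • φ := by
    rw [hF, WithLp.sub_snd, WithLp.smul_snd, ← hψ, sub_add_cancel]
  have hF1 : ‖F.fst‖ ≤ ‖F‖ := WithLp.norm_fst_le _ F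
  have hF2 : ‖F.snd‖ ≤ ‖F‖ := WithLp.norm_snd_le _ F
  have hφb : ‖φ‖ ≤ B * ‖F‖ := by
    set y := ((2 * r * c1 - lam * vol * s1 : ℝ) : ℂ) • φ - adjacency g φ with hy
    -- Testing with `Λ b`, which solves the homogeneous equation, eliminates `u` and leaves only
    -- vertex values and data. The choice `b = y` below then bounds `y`.
    have key : ∀ b : lp (fun _ : Γ => ℂ) 2,
        inner ℂ b y = inner ℂ (Λ b) F.fst + v * s1 * inner ℂ b F.snd := by
      intro b
      have h1 := hW (WithLp.toLp 2 (Λ b, (v : ℂ) • (s1 : ℂ) • b)) (liftDeriv g lam c s c1 s1 b)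
        ((inFormDomain_iff g hvol _ _).2 (by
          rw [← hvdef]
          change IsGraphH1 (Λ b) _ (pullSrc ((v : ℂ)⁻¹ • (v : ℂ) • (s1 : ℂ) • b))
            (pullTgt g ((v : ℂ)⁻¹ • (v : ℂ) • (s1 : ℂ) • b))
          rw [smul_smul, inv_mul_cancel₀ hv0, one_smul, map_smul, map_smul]
          exact h.isGraphH1_lift g b))
      rw [WithLp.prod_inner_apply] at h1
      change _ = inner ℂ (Λ b) W.fst + inner ℂ ((v : ℂ) • (s1 : ℂ) • b) W.snd at h1
      have h2 := congrArg (starRingEnd ℂ) (h.green g b φ hD)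
      rw [map_sub, map_mul, inner_conj_symm, inner_conj_symm, inner_conj_symm,
        Complex.conj_ofReal] at h2
      rw [hW1, hW2] at h1
      simp only [inner_add_right, inner_sub_left, inner_smul_left, inner_smul_right,
        Complex.conj_ofReal, map_mul, adjacency_symm, map_natCast, map_ofNat] at h1 h2
      rw [hy, inner_sub_right, inner_smul_right]
      push_cast
      rw [← hvvc]
      linear_combination h1 - h2
    have h1 : ‖y‖ * ‖y‖ ≤ ((‖Λ‖ + v * |s1|) * ‖F‖) * ‖y‖ := by
      calc ‖y‖ * ‖y‖ = ‖inner ℂ y y‖ := by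
            rw [inner_self_eq_norm_sq_to_K, norm_pow, RCLike.norm_ofReal, abs_norm, sq]
        _ ≤ ‖inner ℂ (Λ y) F.fst‖ + ‖(v * s1 : ℂ) * inner ℂ y F.snd‖ := by
            rw [key y]
            exact norm_add_le _ _
        _ ≤ (‖Λ‖ * ‖y‖) * ‖F‖ + (v * |s1|) * (‖y‖ * ‖F‖) := by
            gcongr
            · refine (norm_inner_le_norm _ _).trans ?_
              gcongr
              exact Λ.le_opNorm y
            · rw [norm_mul, norm_mul, Complex.norm_real, Complex.norm_real, Real.norm_eq_abs,
                Real.norm_eq_abs, abs_of_pos hv]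
              gcongr
              exact (norm_inner_le_norm _ _).trans (by gcongr)
        _ = _ := by ring
    have h2 : ‖y‖ ≤ (‖Λ‖ + v * |s1|) * ‖F‖ := by
      rcases (norm_nonneg y).eq_or_lt with h0 | h0
      · rw [← h0]; positivity
      · exact le_of_mul_le_mul_right h1 h0
    calc ‖φ‖ ≤ K * ‖y‖ := hK φ
      _ ≤ K * ((‖Λ‖ + v * |s1|) * ‖F‖) := by gcongr
      _ = _ := by rw [hB]; ring
  have hs1' : (s1 : ℂ) ≠ 0 := by exact_mod_cast hs1
  -- `Λ φ` has vertex values `s1 φ`, hence the factor `1 / s1`.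
  set Z := D + (-(s1 : ℂ)⁻¹) • liftDeriv g lam c s c1 s1 φ with hZ
  have hZH : IsGraphH1 (U.fst + (-(s1 : ℂ)⁻¹) • Λ φ) Z 0 0 := by
    convert hD.add ((h.isGraphH1_lift g φ).smul (-(s1 : ℂ)⁻¹)) using 1
    · rw [smul_smul, neg_mul, inv_mul_cancel₀ hs1', neg_one_smul, add_neg_cancel]
    · rw [smul_smul, neg_mul, inv_mul_cancel₀ hs1', neg_one_smul, add_neg_cancel]
  have hJZ : edgeInt Z = U.fst + (-(s1 : ℂ)⁻¹) • Λ φ := by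
    rw [hZH.1, map_zero, zero_add]
  have hNZ : edgeMean Z = 0 := by
    have := hZH.2
    rw [zero_add] at this
    exact this.symm
  have hZb := hCb Z F.fst hNZ (by
    intro w hw
    have hwH : IsGraphH1 (edgeInt w) w 0 0 := by
      constructor
      · rw [map_zero, zero_add]
      · rw [hw, zero_add]
    have h1 := hW (WithLp.toLp 2 (edgeInt w, 0)) w ((inFormDomain_iff g hvol _ _).2 (by
      change IsGraphH1 (edgeInt w) w (pullSrc (_ • 0)) (pullTgt g (_ • 0))
      rw [smul_zero, map_zero, map_zero]
      exact hwH))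
    rw [WithLp.prod_inner_apply] at h1
    change _ = inner ℂ (edgeInt w) W.fst + inner ℂ 0 W.snd at h1
    rw [inner_zero_left, hW1, inner_add_right, inner_smul_right] at h1
    have h2 := (h.isGraphH1_liftDeriv g φ).inner_add hwH
    rw [← hΛ, inner_smul_right, inner_zero_left, inner_zero_left] at h2
    rw [hJZ, hZ, inner_add_right, inner_add_right, inner_smul_right, inner_smul_right]
    linear_combination h1 - (s1 : ℂ)⁻¹ * h2)
  have hu : ‖U.fst‖ ≤ C * ‖F‖ + |s1|⁻¹ * (‖Λ‖ * (B * ‖F‖)) := by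
    have : U.fst = edgeInt Z + (s1 : ℂ)⁻¹ • Λ φ := by rw [hJZ]; module
    rw [this]
    refine (norm_add_le _ _).trans ?_
    rw [norm_smul, norm_inv, Complex.norm_real, Real.norm_eq_abs]
    gcongr
    · exact hZb.trans (by gcongr)
    · exact (Λ.le_opNorm _).trans (by gcongr)
  have hs : ‖U.snd‖ ≤ v * (B * ‖F‖) := by
    rw [hψ, norm_smul, Complex.norm_real, Real.norm_eq_abs, abs_of_pos hv]
    gcongr
  calc ‖U‖ ≤ ‖U.fst‖ + ‖U.snd‖ := norm_toLp_le U
    _ ≤ (C * ‖F‖ + |s1|⁻¹ * (‖Λ‖ * (B * ‖F‖))) + v * (B * ‖F‖) := add_le_add hu hs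
    _ = _ := by ring

/-- For functions solving the equation exactly inside the edges, the defect of `Q₀ - lam` sits in
the vertex component alone and is the flux imbalance `y`. -/
lemma isLimitOp_of_boundary (g : Fin r → Γ) {vol : ℝ} (hvol : 0 < vol) {u D : GraphL2 (Γ × Fin r)}
    {φ y : lp (fun _ : Γ => ℂ) 2} (hu : IsGraphH1 u D (pullSrc φ) (pullTgt g φ))
    (hy : ∀ (φ' : lp (fun _ : Γ => ℂ) 2) (u' D' : GraphL2 (Γ × Fin r)),
      IsGraphH1 u' D' (pullSrc φ') (pullTgt g φ') →
      inner ℂ D' D - lam * inner ℂ u' u = lam * vol * inner ℂ φ' φ + inner ℂ φ' y) :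
    IsLimitOp (fun e : Γ × Fin r => e.1) (fun e : Γ × Fin r => e.1 + g e.2) vol
      (WithLp.toLp 2 (u, (Real.sqrt vol : ℂ) • φ))
      ((lam : ℂ) • WithLp.toLp 2 (u, (Real.sqrt vol : ℂ) • φ) +
        WithLp.toLp 2 (0, (Real.sqrt vol : ℂ)⁻¹ • y)) := by
  have hv : 0 < Real.sqrt vol := Real.sqrt_pos.2 hvol
  have hvv : Real.sqrt vol * Real.sqrt vol = vol := Real.mul_self_sqrt hvol.le
  set v := Real.sqrt vol with hvdef
  have hv0 : (v : ℂ) ≠ 0 := by exact_mod_cast hv.ne'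
  have hvvc : (v : ℂ) * v = vol := by exact_mod_cast hvv
  refine ⟨D, (inFormDomain_iff g hvol _ _).2 ?_, fun U' D' h' => ?_⟩
  · rw [← hvdef]
    change IsGraphH1 u D (pullSrc ((v : ℂ)⁻¹ • (v : ℂ) • φ)) (pullTgt g ((v : ℂ)⁻¹ • (v : ℂ) • φ))
    rwa [smul_smul, inv_mul_cancel₀ hv0, one_smul]
  · rw [inFormDomain_iff g hvol, ← hvdef] at h'
    set φ' := (v : ℂ)⁻¹ • U'.snd with hφ'
    have hψ : U'.snd = (v : ℂ) • φ' := by rw [hφ', smul_smul, mul_inv_cancel₀ hv0, one_smul]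
    have h1 := hy φ' _ _ h'
    rw [inner_add_right, inner_smul_right, WithLp.prod_inner_apply, WithLp.prod_inner_apply]
    change _ = (lam : ℂ) * (inner ℂ U'.fst u + inner ℂ U'.snd ((v : ℂ) • φ)) +
      (inner ℂ U'.fst 0 + inner ℂ U'.snd ((v : ℂ)⁻¹ • y))
    rw [hψ, inner_zero_right]
    simp only [inner_smul_left, inner_smul_right, Complex.conj_ofReal]
    rw [← hvvc] at h1
    have h2 : (v : ℂ) * ((v : ℂ)⁻¹ * inner ℂ φ' y) = inner ℂ φ' y := by
      rw [← mul_assoc, mul_inv_cancel₀ hv0, one_mul]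
    linear_combination h1 - h2

lemma norm_toLp_zero_left {X Y : Type*} [NormedAddCommGroup X] [NormedAddCommGroup Y] (y : Y) :
    ‖(WithLp.toLp 2 ((0 : X), y) : WithLp 2 (X × Y))‖ ≤ ‖y‖ := by
  refine (norm_toLp_le _).trans ?_
  change ‖(0 : X)‖ + ‖y‖ ≤ _
  rw [norm_zero, zero_add]

lemma IsFundamental.mem_cayleySpectrum_of_adjacency (h : IsFundamental lam c s c1 s1)
    (hs1 : s1 ≠ 0) (g : Fin r → Γ) {vol : ℝ} (hvol : 0 < vol)
    (hK : ∀ η : ℝ, 0 < η → ∃ φ : lp (fun _ : Γ => ℂ) 2, φ ≠ 0 ∧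
      ‖((2 * r * c1 - lam * vol * s1 : ℝ) : ℂ) • φ - adjacency g φ‖ ≤ η * ‖φ‖) :
    lam ∈ cayleySpectrum g vol := by
  have hv : 0 < Real.sqrt vol := Real.sqrt_pos.2 hvol
  apply mem_cayleySpectrum_of_approx g
  intro η hη
  -- The lift has vertex component `vol^(1/2) s1 b` and its defect carries `vol^(-1/2)`, which
  -- accounts for `vol * |s1|`.
  obtain ⟨b, hb, hbη⟩ := hK (η * vol * |s1|) (by positivity)
  have hL := isLimitOp_of_boundary (lam := lam) g hvol (φ := (s1 : ℂ) • b)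
    (y := ((2 * r * c1 - lam * vol * s1 : ℝ) : ℂ) • b - adjacency g b)
    (by rw [map_smul, map_smul]; exact h.isGraphH1_lift g b) (by
    intro φ' u' D' h'
    rw [h.green g b φ' h']
    simp only [inner_sub_right, inner_smul_right]
    push_cast
    ring)
  refine ⟨_, _, hL, ?_, ?_⟩
  · intro h0
    have h1 := congrArg WithLp.snd h0
    change (Real.sqrt vol : ℂ) • (s1 : ℂ) • b = 0 at h1
    rw [smul_eq_zero, smul_eq_zero] at h1
    norm_cast at h1
    exact h1.elim hv.ne' fun h2 => h2.elim hs1 hb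
  · rw [add_sub_cancel_left]
    refine (norm_toLp_zero_left _).trans ?_
    have h1 : ‖(Real.sqrt vol : ℂ) • (s1 : ℂ) • b‖ ≤ ‖(WithLp.toLp 2 (lift g c s c1 s1 b,
      (Real.sqrt vol : ℂ) • (s1 : ℂ) • b) : ExtSpace (Γ × Fin r) Γ)‖ :=
        WithLp.norm_snd_le _ (WithLp.toLp 2 (lift g c s c1 s1 b,
          (Real.sqrt vol : ℂ) • (s1 : ℂ) • b) : ExtSpace (Γ × Fin r) Γ)
    refine le_trans ?_ (mul_le_mul_of_nonneg_left h1 hη.le)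
    simp only [norm_smul, norm_inv, Complex.norm_real, Real.norm_eq_abs, abs_of_pos hv]
    rw [inv_mul_le_iff₀ hv]
    refine hbη.trans (le_of_eq ?_)
    nth_rewrite 1 [← Real.mul_self_sqrt hvol.le]
    ring

/-- Now `s` vanishes at both ends, so `x e • s` on the edges with zero vertex values is admissible
for every `x`. Its slopes are `x e` and `c1 * x e`, so `y` measures the failure of Kirchhoff's law
for `x`. -/
lemma IsFundamental.mem_cayleySpectrum_of_flow (h : IsFundamental lam c s c1 s1)
    (hs1 : s1 = 0) (g : Fin r → Γ) {vol : ℝ} (hvol : 0 < vol)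
    (hK : ∀ η : ℝ, 0 < η → ∃ (x : lp (fun _ : Γ × Fin r => ℂ) 2) (y : lp (fun _ : Γ => ℂ) 2),
      x ≠ 0 ∧ ‖y‖ ≤ η * ‖x‖ ∧ ∀ φ : lp (fun _ : Γ => ℂ) 2,
        c1 * inner ℂ (pullTgt g φ) x - inner ℂ (pullSrc φ) x = inner ℂ φ y) :
    lam ∈ cayleySpectrum g vol := by
  have hv : 0 < Real.sqrt vol := Real.sqrt_pos.2 hvol
  -- If `s = 0` then `c = 1`, whose mean is `1` and not `s1 = 0`.
  have hs : s ≠ 0 := by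
    rintro rfl
    have h1 := h.int_s
    rw [map_zero, smul_zero, add_zero] at h1
    have h2 := h.mean_c
    rw [h1, inner_edgeOne_self, hs1] at h2
    simp at h2
  apply mem_cayleySpectrum_of_approx g
  intro η hη
  have hs' : 0 < ‖s‖ := norm_pos_iff.2 hs
  obtain ⟨x, y, hx, hyη, hxy⟩ := hK (η * Real.sqrt vol * ‖s‖) (by positivity)
  have hL := isLimitOp_of_boundary (lam := lam) g hvol (φ := 0)
    (u := edgeTensor s x) (D := edgeTensor c x) (y := y)
    (by
      have := h.isGraphH1_s x
      rw [hs1, Complex.ofReal_zero, zero_smul] at this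
      rwa [map_zero, map_zero]) (by
    intro φ' u' D' h'
    have h1 := (h.isGraphH1_c x).inner_add h'
    have h2 := hxy φ'
    rw [inner_smul_right, inner_smul_right] at h1
    rw [inner_zero_right]
    linear_combination h1 + h2)
  refine ⟨_, _, hL, ?_, ?_⟩
  · intro h0
    have h1 := congrArg WithLp.fst h0
    change edgeTensor s x = 0 at h1
    rw [← norm_eq_zero, norm_edgeTensor, mul_eq_zero, norm_eq_zero, norm_eq_zero] at h1
    tauto
  · rw [add_sub_cancel_left]
    refine (norm_toLp_zero_left _).trans ?_
    have h1 : ‖edgeTensor s x‖ ≤ ‖(WithLp.toLp 2 (edgeTensor s x,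
      (Real.sqrt vol : ℂ) • 0) : ExtSpace (Γ × Fin r) Γ)‖ :=
        WithLp.norm_fst_le _ (WithLp.toLp 2 (edgeTensor s x, (Real.sqrt vol : ℂ) • 0) :
          ExtSpace (Γ × Fin r) Γ)
    refine le_trans ?_ (mul_le_mul_of_nonneg_left h1 hη.le)
    rw [norm_edgeTensor]
    simp only [norm_smul, norm_inv, Complex.norm_real, Real.norm_eq_abs, abs_of_pos hv]
    rw [inv_mul_le_iff₀ hv]
    refine hyη.trans (le_of_eq ?_)
    ring

end cayley


/-! ### Characters and the spectrum of the adjacency operator. -/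

/-- In a Banach algebra, an element of a closed commutative subalgebra which is not invertible is
in the kernel of a contractive character. -/
lemma exists_character_apply_eq_zero {B : Type*} [NormedRing B] [NormedAlgebra ℂ B]
    [CompleteSpace B] (S : Subalgebra ℂ B) (hS : IsClosed (S : Set B))
    (hcomm : ∀ x y : S, x * y = y * x) {a : S} (ha : ¬ IsUnit (a : B)) :
    ∃ χ : S →ₐ[ℂ] ℂ, χ a = 0 ∧ ∀ x : S, ‖χ x‖ ≤ ‖(x : B)‖ * ‖(1 : B)‖ := by
  let : NormedCommRing S := { (inferInstance : NormedRing S) with mul_comm := hcomm }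
  have : CompleteSpace S := hS.completeSpace_coe
  -- Only the trivial direction is needed: an inverse in `S` would be an inverse in `B`.
  have ha' : ¬ IsUnit a := fun h => ha (h.map S.val)
  obtain ⟨f, hf⟩ := WeakDual.CharacterSpace.exists_apply_eq_zero ha'
  exact ⟨WeakDual.CharacterSpace.equivAlgHom f, hf,
    fun x => AlgHom.norm_apply_le_self_mul_norm_one (WeakDual.CharacterSpace.equivAlgHom f) x⟩

section translate

variable {Γ : Type*} [AddCommGroup Γ] {r : ℕ}

lemma translate_mul (a b : Γ) : translate a * translate b = translate (a + b) := by
  ext φ γ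
  simp [translate, add_assoc]

lemma translate_zero : translate (0 : Γ) = 1 := by
  ext φ γ
  simp [translate]

lemma translate_pow (a : Γ) (n : ℕ) : translate a ^ n = translate (n • a) := by
  induction n with
  | zero => rw [pow_zero, zero_smul, translate_zero]
  | succ n ih => rw [pow_succ, ih, translate_mul, succ_nsmul]

lemma norm_translate_le (a : Γ) : ‖translate a‖ ≤ 1 := norm_shift_le _

/-- The closed commutative algebra generated by the translations. -/
def translateAlgebra (Γ : Type*) [AddCommGroup Γ] :
    Subalgebra ℂ (lp (fun _ : Γ => ℂ) 2 →L[ℂ] lp (fun _ : Γ => ℂ) 2) :=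
  (Algebra.adjoin ℂ (Set.range (translate (Γ := Γ)))).topologicalClosure

lemma translate_mem (a : Γ) : translate a ∈ translateAlgebra Γ :=
  Subalgebra.le_topologicalClosure _ (Algebra.subset_adjoin ⟨a, rfl⟩)

lemma translateAlgebra_comm (x y : translateAlgebra Γ) : x * y = y * x := by
  have hc : ∀ a ∈ Set.range (translate (Γ := Γ)), ∀ b ∈ Set.range (translate (Γ := Γ)),
      a * b = b * a := by
    rintro _ ⟨a, rfl⟩ _ ⟨b, rfl⟩
    rw [translate_mul, translate_mul, add_comm]
  have := Algebra.isMulCommutative_adjoin ℂ hc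
  let := Subalgebra.commRingTopologicalClosure
    (Algebra.adjoin ℂ (Set.range (translate (Γ := Γ)))) (fun x y => IsMulCommutative.is_comm.comm x y)
  exact mul_comm (G := (Algebra.adjoin ℂ (Set.range (translate (Γ := Γ)))).topologicalClosure) x y

lemma _root_.AlgHom.map_algebraMap_sub_sum {S ι : Type*} [Fintype ι] [Ring S] [Algebra ℂ S]
    (χ : S →ₐ[ℂ] ℂ) (m : ℂ) (u v : ι → S) :
    χ (algebraMap ℂ S m - ∑ j, (u j + v j)) = m - ∑ j, (χ (u j) + χ (v j)) := by
  simp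

/-- Two mutually inverse numbers in the closed unit disc lie on the circle and are conjugate. They
will be the values of a contractive character at opposite translations; `n = 0` imposes nothing on
the angle. -/
lemma exists_angle {z w : ℂ} (hz : ‖z‖ ≤ 1) (hw : ‖w‖ ≤ 1) (hzw : z * w = 1) {n : ℕ}
    (hn : z ^ n = 1) : ∃ θ : ℝ, (∃ m : ℤ, (n : ℝ) * θ = 2 * Real.pi * m) ∧
      z + w = ((2 * Real.cos θ : ℝ) : ℂ) := by
  have h1 : ‖z‖ * ‖w‖ = 1 := by rw [← norm_mul, hzw, norm_one]
  have hz1 : ‖z‖ = 1 := by nlinarith [norm_nonneg z, norm_nonneg w]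
  have hexp : z = Complex.exp (z.arg * Complex.I) := by
    have := Complex.norm_mul_exp_arg_mul_I z
    rwa [hz1, Complex.ofReal_one, one_mul, eq_comm] at this
  refine ⟨z.arg, ?_, ?_⟩
  · rw [hexp, ← Complex.exp_nat_mul, Complex.exp_eq_one_iff] at hn
    obtain ⟨m, hm⟩ := hn
    refine ⟨m, ?_⟩
    have h2 : ((n : ℂ) * z.arg) * Complex.I = (2 * Real.pi * m) * Complex.I := by
      linear_combination hm
    have h3 := mul_right_cancel₀ Complex.I_ne_zero h2
    exact_mod_cast h3
  · have hw' : w = Complex.exp (-(z.arg * Complex.I)) := by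
      rw [Complex.exp_neg, ← hexp]
      exact eq_inv_of_mul_eq_one_right hzw
    nth_rewrite 1 [hexp]
    rw [hw']
    push_cast
    rw [Complex.two_cos, neg_mul]

/-- The spectrum of the adjacency operator consists of values at characters. -/
lemma adjacency_bound (g : Fin r → Γ) (n : Fin r → ℕ) (hg : ∀ j, n j • g j = 0) (m : ℝ)
    (hm : ∀ θ : Fin r → ℝ, IsCharacterAngle n θ → ∑ j, 2 * Real.cos (θ j) ≠ m) :
    ∃ K : ℝ, 0 ≤ K ∧ ∀ φ : lp (fun _ : Γ => ℂ) 2, ‖φ‖ ≤ K * ‖(m : ℂ) • φ - adjacency g φ‖ := by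
  have hu : IsUnit ((m : ℂ) • 1 - adjacency g) := by
    by_contra hu
    let t : Γ → translateAlgebra Γ := fun a => ⟨translate a, translate_mem a⟩
    let a : translateAlgebra Γ := algebraMap ℂ _ (m : ℂ) - ∑ j, (t (g j) + t (-g j))
    have ha : (a : lp (fun _ : Γ => ℂ) 2 →L[ℂ] lp (fun _ : Γ => ℂ) 2) =
        (m : ℂ) • 1 - adjacency g := by
      simp [a, t, adjacency, Algebra.algebraMap_eq_smul_one]
      rfl
    obtain ⟨χ, hχ0, hχ⟩ := exists_character_apply_eq_zero (translateAlgebra Γ)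
      (Subalgebra.isClosed_topologicalClosure _) translateAlgebra_comm (a := a) (by rwa [ha])
    have ht1 : ∀ b, ‖χ (t b)‖ ≤ 1 := fun b => by
      refine (hχ _).trans ?_
      exact mul_le_one₀ (norm_translate_le b) (norm_nonneg _) ContinuousLinearMap.norm_id_le
    have hmul : ∀ b b', t b * t b' = t (b + b') := fun b b' => Subtype.ext (translate_mul b b')
    have hone : t 0 = 1 := Subtype.ext translate_zero
    have hpow : ∀ b (k : ℕ), t b ^ k = t (k • b) := fun b k => Subtype.ext (translate_pow b k)
    -- The algebra character restricts to a unitary character of `Γ`; its angles at the generators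
    -- make `∑ 2 cos θ_j` equal to `m`.
    choose θ hθ1 hθ2 using fun j => exists_angle (ht1 (g j)) (ht1 (-g j))
      (by rw [← map_mul, hmul, add_neg_cancel, hone, map_one]) (n := n j)
      (by rw [← map_pow, hpow, hg, hone, map_one])
    apply hm θ hθ1
    rw [show a = algebraMap ℂ _ (m : ℂ) - ∑ j, (t (g j) + t (-g j)) from rfl,
      AlgHom.map_algebraMap_sub_sum, sub_eq_zero, Finset.sum_congr rfl fun j _ => hθ2 j] at hχ0
    exact_mod_cast hχ0.symm
  obtain ⟨N, hN⟩ := hu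
  refine ⟨‖(↑N⁻¹ : lp (fun _ : Γ => ℂ) 2 →L[ℂ] lp (fun _ : Γ => ℂ) 2)‖, norm_nonneg _,
    fun φ => ?_⟩
  have h1 := congrArg (fun T : lp (fun _ : Γ => ℂ) 2 →L[ℂ] lp (fun _ : Γ => ℂ) 2 => T φ) N.inv_mul
  change (↑N⁻¹ : lp (fun _ : Γ => ℂ) 2 →L[ℂ] lp (fun _ : Γ => ℂ) 2)
    ((N : lp (fun _ : Γ => ℂ) 2 →L[ℂ] lp (fun _ : Γ => ℂ) 2) φ) = φ at h1
  nth_rewrite 1 [← h1]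
  refine (ContinuousLinearMap.le_opNorm _ _).trans (le_of_eq ?_)
  rw [hN]
  rfl

end translate

/-! ### Approximate eigenfunctions and flows from damped characters. -/

section approx

/-- An approximate eigenfunction of the translation on `ℤ`. -/
lemma exists_approx_int (θ : ℝ) {η : ℝ} (hη : 0 < η) :
    ∃ f : ℤ → ℂ, f 0 ≠ 0 ∧ (Summable fun x => ‖f x‖ ^ 2) ∧
      ∀ x, ‖f (x + 1) - Complex.exp (θ * Complex.I) * f x‖ ≤ η * ‖f x‖ := by
  -- The function is `exp(iθk) q^|k|`. This `q` satisfies `1 - q = η q`, which is the exact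
  -- requirement for `k < 0`, where the step towards `0` enlarges the modulus.
  set q : ℝ := (1 + η)⁻¹ with hq
  have hq0 : 0 < q := by positivity
  have hq1 : q < 1 := inv_lt_one_of_one_lt₀ (by linarith)
  have hqη : 1 - q = η * q := by rw [hq]; field_simp; ring
  have hηq : 1 - q ≤ η := by rw [hqη]; nlinarith
  have hns : ∀ k : ℤ, ‖Complex.exp (θ * Complex.I) ^ k * ((q ^ k.natAbs : ℝ) : ℂ)‖ =
      q ^ k.natAbs := by
    intro k
    rw [norm_mul, norm_zpow, Complex.norm_exp_ofReal_mul_I, one_zpow, one_mul,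
      Complex.norm_real, Real.norm_eq_abs, abs_of_pos (by positivity)]
  refine ⟨fun k : ℤ => Complex.exp (θ * Complex.I) ^ k * ((q ^ k.natAbs : ℝ) : ℂ), ?_, ?_, ?_⟩
  · rw [← norm_ne_zero_iff]
    exact (hns 0).trans_ne (by positivity)
  · simp only [hns]
    have hs : Summable fun k : ℕ => (q ^ k) ^ 2 := by
      simp_rw [← pow_mul, mul_comm _ 2, pow_mul]
      exact summable_geometric_of_lt_one (by positivity) (by nlinarith)
    apply Summable.of_nat_of_neg
    · simpa using hs
    · simpa using hs
  · intro k
    rw [hns k]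
    beta_reduce
    rw [zpow_add₀ (Complex.exp_ne_zero _), zpow_one,
      show ∀ a b c d : ℂ, a * b * c - b * (a * d) = a * b * (c - d) by intros; ring, norm_mul,
      norm_mul, norm_zpow, Complex.norm_exp_ofReal_mul_I, one_zpow, one_mul, one_mul,
      ← Complex.ofReal_sub, Complex.norm_real, Real.norm_eq_abs]
    rcases lt_or_ge k 0 with hk | hk
    · have h1 : k.natAbs = (k + 1).natAbs + 1 := by omega
      rw [h1, pow_succ]
      have hp : 0 < q ^ (k + 1).natAbs := by positivity
      rw [show q ^ (k + 1).natAbs - q ^ (k + 1).natAbs * q =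
        q ^ (k + 1).natAbs * (1 - q) by ring, hqη, abs_of_nonneg (by positivity)]
      exact le_of_eq (by ring)
    · have h1 : (k + 1).natAbs = k.natAbs + 1 := by omega
      rw [h1, pow_succ]
      have hp : 0 < q ^ k.natAbs := by positivity
      rw [abs_sub_comm, show q ^ k.natAbs - q ^ k.natAbs * q =
        (1 - q) * q ^ k.natAbs by ring, abs_of_nonneg (mul_nonneg (by linarith) hp.le)]
      gcongr

/-- An approximate eigenfunction of the translation on `ℤ/n`. -/
lemma exists_approx_zmod (n : ℕ) {θ : ℝ} (hθ : ∃ m : ℤ, (n : ℝ) * θ = 2 * Real.pi * m) {η : ℝ}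
    (hη : 0 < η) : ∃ f : ZMod n → ℂ, f 0 ≠ 0 ∧ (Summable fun x => ‖f x‖ ^ 2) ∧
      ∀ x, ‖f (x + 1) - Complex.exp (θ * Complex.I) * f x‖ ≤ η * ‖f x‖ := by
  cases n with
  -- `ZMod 0` is `ℤ` by definition. In the finite case the character itself is an exact
  -- eigenfunction.
  | zero => exact exists_approx_int θ hη
  | succ n =>
    obtain ⟨m, hm⟩ := hθ
    have hz : Complex.exp (θ * Complex.I) ^ (n + 1) = 1 := by
      rw [← Complex.exp_nat_mul, Complex.exp_eq_one_iff]
      refine ⟨m, ?_⟩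
      have : (((n + 1 : ℕ) : ℝ) : ℂ) * θ = 2 * Real.pi * m := by exact_mod_cast hm
      push_cast at this ⊢
      linear_combination Complex.I * this
    refine ⟨fun x => Complex.exp (θ * Complex.I) ^ x.val, ?_, Summable.of_finite, fun x => ?_⟩
    · exact pow_ne_zero _ (Complex.exp_ne_zero _)
    · have : Complex.exp (θ * Complex.I) ^ (x + 1).val =
          Complex.exp (θ * Complex.I) * Complex.exp (θ * Complex.I) ^ x.val := by
        rw [← pow_succ', ZMod.val_add, ZMod.val_one_eq_one_mod, Nat.add_mod_mod]
        exact (pow_eq_pow_mod _ hz).symm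
      simp only [this, sub_self, norm_zero]
      positivity

variable {Γ : Type*} [AddCommGroup Γ] {r : ℕ}

/-- A finite set is contained in the box of its projections, and over a box the sum of products
factorizes. -/
lemma memlp_pi_prod {κ : Fin r → Type*} {f : ∀ j, κ j → ℂ}
    (hf : ∀ j, Summable fun x => ‖f j x‖ ^ 2) :
    Memℓp (fun x : ∀ j, κ j => ∏ j, f j (x j)) 2 := by
  classical
  refine memlp_two_of_sum_le (C := ∏ j, ∑' x, ‖f j x‖ ^ 2) fun s => ?_
  calc ∑ x ∈ s, ‖∏ j, f j (x j)‖ ^ 2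
      ≤ ∑ x ∈ Fintype.piFinset fun j => s.image fun x => x j, ∏ j, ‖f j (x j)‖ ^ 2 := by
        simp only [norm_prod, Finset.prod_pow]
        refine Finset.sum_le_sum_of_subset_of_nonneg (fun x hx => ?_) fun _ _ _ => by positivity
        exact Fintype.mem_piFinset.2 fun j => Finset.mem_image_of_mem _ hx
    _ = ∏ j, ∑ x ∈ s.image fun x => x j, ‖f j x‖ ^ 2 :=
        (Finset.prod_univ_sum (fun j => s.image fun x => x j) fun j x => ‖f j x‖ ^ 2).symm
    _ ≤ ∏ j, ∑' x, ‖f j x‖ ^ 2 := by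
        refine Finset.prod_le_prod (fun j _ => by positivity) fun j _ => ?_
        exact (hf j).sum_le_tsum _ fun _ _ => by positivity

/-- Approximate joint eigenfunctions of the translations. -/
lemma exists_approx (n : Fin r → ℕ) (e : Γ ≃+ ((j : Fin r) → ZMod (n j))) {θ : Fin r → ℝ}
    (hθ : IsCharacterAngle n θ) {η : ℝ} (hη : 0 < η) :
    ∃ φ : lp (fun _ : Γ => ℂ) 2, φ ≠ 0 ∧ ∀ j,
      ‖translate (e.symm (Pi.single j 1)) φ - Complex.exp (θ j * Complex.I) • φ‖ ≤ η * ‖φ‖ := by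
  choose f hf0 hf hfη using fun j => exists_approx_zmod (n j) (hθ j) hη
  have hmem : Memℓp (fun γ : Γ => ∏ j, f j (e γ j)) 2 := by
    have h1 : Memℓp (fun x : (j : Fin r) → ZMod (n j) => ∏ j, f j (x j)) 2 := memlp_pi_prod hf
    have h2 : Summable fun x : (j : Fin r) → ZMod (n j) => ‖∏ j, f j (x j)‖ ^ 2 := by
      simpa using h1.summable (by norm_num)
    refine memlp_two_of_sum_le (C := ∑' γ : Γ, ‖∏ j, f j (e γ j)‖ ^ 2) fun s => ?_
    exact (e.toEquiv.summable_iff.2 h2).sum_le_tsum s fun _ _ => by positivity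
  refine ⟨⟨_, hmem⟩, ?_, fun j => ?_⟩
  · intro h
    have h1 := congrArg (fun φ : lp (fun _ : Γ => ℂ) 2 => φ 0) h
    change ∏ j, f j (e 0 j) = 0 at h1
    rw [map_zero] at h1
    exact Finset.prod_ne_zero_iff.2 (fun j _ => hf0 j) h1
  · refine norm_le_of_sum_sq_le (by positivity) fun s => ?_
    rw [mul_pow]
    refine le_trans ?_ (mul_le_mul_of_nonneg_left (sum_sq_le_norm_sq _ s) (sq_nonneg _))
    rw [Finset.mul_sum]
    refine Finset.sum_le_sum fun γ _ => ?_
    rw [← mul_pow]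
    gcongr
    change ‖∏ i, f i (e (γ + e.symm (Pi.single j 1)) i) -
      Complex.exp (θ j * Complex.I) * ∏ i, f i (e γ i)‖ ≤ η * ‖∏ i, f i (e γ i)‖
    rw [map_add, AddEquiv.apply_symm_apply, ← Finset.mul_prod_erase _ _ (Finset.mem_univ j),
      ← Finset.mul_prod_erase Finset.univ (fun i => f i (e γ i)) (Finset.mem_univ j)]
    -- Translation by the `j`-th generator changes only the `j`-th factor of the product.
    have h1 : ∏ i ∈ Finset.univ.erase j, f i ((e γ + Pi.single j 1 : (j : Fin r) → ZMod (n j)) i) =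
        ∏ i ∈ Finset.univ.erase j, f i (e γ i) := by
      refine Finset.prod_congr rfl fun i hi => ?_
      rw [Pi.add_apply, Pi.single_eq_of_ne (Finset.ne_of_mem_erase hi), add_zero]
    rw [h1, Pi.add_apply, Pi.single_eq_same, ← mul_assoc, ← sub_mul, norm_mul, norm_mul,
      ← mul_assoc]
    gcongr
    exact hfη j _

lemma norm_translate_neg_sub_le (a : Γ) (z w : ℂ) (φ : lp (fun _ : Γ => ℂ) 2) :
    ‖z • φ - w • translate (-a) φ‖ ≤ ‖z • translate a φ - w • φ‖ := by
  have h1 : z • φ - w • translate (-a) φ = translate (-a) (z • translate a φ - w • φ) := by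
    have h2 : translate (-a) (translate a φ) = φ := by
      have := congrArg (fun T : lp (fun _ : Γ => ℂ) 2 →L[ℂ] lp (fun _ : Γ => ℂ) 2 => T φ)
        (translate_mul (-a) a)
      rw [neg_add_cancel, translate_zero] at this
      exact this
    rw [map_sub, map_smul, map_smul, h2]
  rw [h1]
  refine (ContinuousLinearMap.le_opNorm _ _).trans ?_
  exact mul_le_of_le_one_left (norm_nonneg _) (norm_translate_le _)

lemma exists_approx_adjacency (n : Fin r → ℕ) (e : Γ ≃+ ((j : Fin r) → ZMod (n j)))
    {θ : Fin r → ℝ} (hθ : IsCharacterAngle n θ) {η : ℝ} (hη : 0 < η) :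
    ∃ φ : lp (fun _ : Γ => ℂ) 2, φ ≠ 0 ∧
      ‖((∑ j, 2 * Real.cos (θ j) : ℝ) : ℂ) • φ -
        adjacency (fun j => e.symm (Pi.single j 1)) φ‖ ≤ η * ‖φ‖ := by
  -- There are `2r` translations; the extra `1` covers `r = 0`.
  obtain ⟨φ, hφ0, hφ⟩ := exists_approx n e hθ (η := η / (2 * r + 1)) (by positivity)
  refine ⟨φ, hφ0, ?_⟩
  have h1 : ((∑ j, 2 * Real.cos (θ j) : ℝ) : ℂ) • φ -
      adjacency (fun j => e.symm (Pi.single j 1)) φ =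
      ∑ j, ((Complex.exp (θ j * Complex.I) • φ - translate (e.symm (Pi.single j 1)) φ) +
        (Complex.exp (-θ j * Complex.I) • φ - translate (-e.symm (Pi.single j 1)) φ)) := by
    rw [adjacency, sum_apply, Complex.ofReal_sum, Finset.sum_smul, ← Finset.sum_sub_distrib]
    refine Finset.sum_congr rfl fun j _ => ?_
    push_cast
    rw [Complex.two_cos, Pi.add_apply]
    module
  have h2 : ∀ j, ‖(Complex.exp (θ j * Complex.I) • φ - translate (e.symm (Pi.single j 1)) φ) +
        (Complex.exp (-θ j * Complex.I) • φ - translate (-e.symm (Pi.single j 1)) φ)‖ ≤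
        2 * (η / (2 * r + 1)) * ‖φ‖ := by
    intro j
    have h3 := hφ j
    have h4 := norm_translate_neg_sub_le (e.symm (Pi.single j 1))
      (Complex.exp (-θ j * Complex.I)) 1 φ
    have h5 : Complex.exp (-θ j * Complex.I) • translate (e.symm (Pi.single j 1)) φ -
        (1 : ℂ) • φ = Complex.exp (-θ j * Complex.I) •
          (translate (e.symm (Pi.single j 1)) φ - Complex.exp (θ j * Complex.I) • φ) := by
      rw [smul_sub, smul_smul, ← Complex.exp_add]
      simp
    have h6 : ‖Complex.exp (-θ j * Complex.I)‖ = 1 := by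
      have := Complex.norm_exp_ofReal_mul_I (-θ j)
      push_cast at this
      exact this
    rw [h5, norm_smul, h6, one_mul, one_smul] at h4
    rw [norm_sub_rev] at h3
    refine (norm_add_le _ _).trans ?_
    rw [norm_sub_rev] at h3
    rw [norm_sub_rev (Complex.exp (θ j * Complex.I) • φ)]
    linarith
  rw [h1]
  refine (norm_sum_le _ _).trans ((Finset.sum_le_sum fun j _ => h2 j).trans ?_)
  rw [Finset.sum_const, Finset.card_univ, Fintype.card_fin, nsmul_eq_mul]
  calc (r : ℝ) * (2 * (η / (2 * r + 1)) * ‖φ‖) = (2 * r) / (2 * r + 1) * (η * ‖φ‖) := by ring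
    _ ≤ 1 * (η * ‖φ‖) := by
        gcongr
        rw [div_le_one (by positivity)]
        linarith
    _ = _ := one_mul _

/-- Approximate flows, concentrated on the edges in one direction. -/
lemma exists_approx_flow (n : Fin r → ℕ) (e : Γ ≃+ ((j : Fin r) → ZMod (n j))) {j₀ : Fin r}
    (hj₀ : n j₀ = 0) {c : ℝ} (hc : c = 1 ∨ c = -1) {η : ℝ} (hη : 0 < η) :
    ∃ (x : lp (fun _ : Γ × Fin r => ℂ) 2) (y : lp (fun _ : Γ => ℂ) 2),
      x ≠ 0 ∧ ‖y‖ ≤ η * ‖x‖ ∧ ∀ φ : lp (fun _ : Γ => ℂ) 2,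
        c * inner ℂ (pullTgt (fun j => e.symm (Pi.single j 1)) φ) x -
          inner ℂ (pullSrc φ) x = inner ℂ φ y := by
  obtain ⟨ϑ, hϑ⟩ : ∃ ϑ : ℝ, Complex.exp (ϑ * Complex.I) = c := by
    rcases hc with rfl | rfl
    · exact ⟨0, by simp⟩
    · exact ⟨Real.pi, by simp⟩
  -- The factor `j₀` is `ℤ`, so the angle of the sign `c` is allowed there; the other angles are
  -- trivial.
  have hθ : IsCharacterAngle n (Pi.single j₀ ϑ) := by
    intro j
    by_cases hj : j = j₀
    · subst hj
      exact ⟨0, by simp [hj₀]⟩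
    · exact ⟨0, by simp [hj]⟩
  obtain ⟨Φ, hΦ0, hΦ⟩ := exists_approx n e hθ hη
  have hΦj := hΦ j₀
  rw [Pi.single_eq_same, hϑ] at hΦj
  have hinj : Function.Injective fun γ : Γ => (γ, j₀) := fun a b h => (Prod.ext_iff.1 h).1
  classical
  have hmem : Memℓp (fun p : Γ × Fin r => if p.2 = j₀ then Φ p.1 else 0) 2 := by
    refine memlp_two_of_sum_le (C := (Real.sqrt r * ‖Φ‖) ^ 2) fun s => ?_
    refine le_trans (Finset.sum_le_sum fun p _ => ?_)
      (sum_sq_pull_le (fun _ => Equiv.refl Γ) Φ s)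
    split_ifs
    · exact le_rfl
    · rw [norm_zero, zero_pow two_ne_zero]
      positivity
  set x : lp (fun _ : Γ × Fin r => ℂ) 2 := ⟨_, hmem⟩ with hx
  have hxe : ∀ p, x p = if p.2 = j₀ then Φ p.1 else 0 := fun p => rfl
  have hin : ∀ z : lp (fun _ : Γ × Fin r => ℂ) 2,
      inner ℂ z x = ∑' γ, inner ℂ (z (γ, j₀)) (Φ γ) := by
    intro z
    rw [lp.inner_eq_tsum, ← hinj.tsum_eq]
    · refine tsum_congr fun γ => ?_
      rw [hxe, if_pos rfl]
    · intro p hp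
      by_cases h : p.2 = j₀
      · exact ⟨p.1, by rw [← h]⟩
      · refine absurd ?_ hp
        change inner ℂ (z p) (x p) = 0
        rw [show x p = 0 from if_neg h, inner_zero_right]
  have hsrc : ∀ φ : lp (fun _ : Γ => ℂ) 2, inner ℂ (pullSrc φ) x = inner ℂ φ Φ := by
    intro φ
    rw [hin, lp.inner_eq_tsum]
    rfl
  have htgt : ∀ φ : lp (fun _ : Γ => ℂ) 2,
      inner ℂ (pullTgt (fun j => e.symm (Pi.single j 1)) φ) x =
        inner ℂ φ (translate (-e.symm (Pi.single j₀ 1)) Φ) := by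
    intro φ
    rw [hin, lp.inner_eq_tsum, ← (Equiv.addRight (e.symm (Pi.single j₀ 1))).tsum_eq
      fun γ => inner ℂ (φ γ) (translate (-e.symm (Pi.single j₀ 1)) Φ γ)]
    refine tsum_congr fun γ => ?_
    have h1 : Φ (γ + e.symm (Pi.single j₀ 1) + -e.symm (Pi.single j₀ 1)) = Φ γ := by
      rw [add_neg_cancel_right]
    exact (congrArg (inner ℂ (φ (γ + e.symm (Pi.single j₀ 1)))) h1).symm
  have hnorm : ‖x‖ = ‖Φ‖ := by
    have h1 : inner ℂ x x = inner ℂ Φ Φ := by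
      rw [hin, lp.inner_eq_tsum]
      refine tsum_congr fun γ => ?_
      rw [hxe, if_pos rfl]
    rw [inner_self_eq_norm_sq_to_K, inner_self_eq_norm_sq_to_K] at h1
    have h2 : ‖x‖ ^ 2 = ‖Φ‖ ^ 2 := by exact_mod_cast h1
    exact (pow_left_inj₀ (norm_nonneg _) (norm_nonneg _) two_ne_zero).1 h2
  -- At each vertex this is `c` times the amplitude arriving in direction `j₀` minus the amplitude
  -- leaving.
  refine ⟨x, (c : ℂ) • translate (-e.symm (Pi.single j₀ 1)) Φ - Φ, ?_, ?_, fun φ => ?_⟩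
  · rw [← norm_ne_zero_iff, hnorm]
    exact norm_ne_zero_iff.2 hΦ0
  · rw [hnorm, norm_sub_rev]
    have := norm_translate_neg_sub_le (e.symm (Pi.single j₀ 1)) 1 c Φ
    rw [one_smul, one_smul] at this
    exact this.trans hΦj
  · rw [hsrc, htgt, inner_sub_right, inner_smul_right]

end approx


/-! ### The spectrum in terms of `c1` and `s1`. -/

lemma edgeOf_const_mul (a : ℝ) {f : ℝ → ℝ} (hf : Continuous f) :
    edgeOf (fun x => a * f x) (hf.const_mul a) = (a : ℂ) • edgeOf f hf := by
  apply Lp.ext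
  filter_upwards [edgeOf_ae _ (hf.const_mul a), Lp.coeFn_smul (a : ℂ) (edgeOf f hf),
    edgeOf_ae f hf] with x h1 h2 h3
  rw [h1, h2, Pi.smul_apply, h3]
  simp

lemma exists_isFundamental {lam : ℝ} {C S : ℝ → ℝ} (hC : ∀ x, HasDerivAt C (-lam * S x) x)
    (hS : ∀ x, HasDerivAt S (C x) x) (hC0 : C 0 = 1) (hS0 : S 0 = 0)
    (hdet : C 1 ^ 2 + lam * S 1 ^ 2 = 1) :
    ∃ c s : EdgeSpace, IsFundamental lam c s (C 1) (S 1) := by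
  have hCc : Continuous C := continuous_iff_continuousAt.2 fun x => (hC x).continuousAt
  have hSc : Continuous S := continuous_iff_continuousAt.2 fun x => (hS x).continuousAt
  refine ⟨edgeOf C hCc, edgeOf S hSc, ?_, ?_, ?_, ?_, hdet⟩
  · rw [volterra_edgeOf hCc hSc hS, hS0, Complex.ofReal_zero, zero_smul, sub_zero]
  · have h := volterra_edgeOf (hSc.const_mul (-lam)) hCc hC
    rw [edgeOf_const_mul _ hSc, map_smul, hC0, Complex.ofReal_one, one_smul] at h
    have h2 : (lam : ℂ) • volterra (edgeOf S hSc) =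
        -(((-lam : ℝ) : ℂ) • volterra (edgeOf S hSc)) := by
      push_cast
      rw [neg_smul, neg_neg]
    rw [h2, h]
    abel
  · rw [inner_edgeOne_edgeOf hCc hS, hS0, sub_zero]
  · have h := inner_edgeOne_edgeOf (hSc.const_mul (-lam)) hC
    rw [edgeOf_const_mul _ hSc, inner_smul_right, hC0] at h
    push_cast at h
    linear_combination -h

section cayley

variable {Γ : Type*} [AddCommGroup Γ] {r : ℕ} {n : Fin r → ℕ}

lemma nsmul_generator (e : Γ ≃+ ((j : Fin r) → ZMod (n j))) (j : Fin r) :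
    n j • e.symm (Pi.single j 1) = 0 := by
  rw [← map_nsmul, ← Pi.single_smul, nsmul_one, ZMod.natCast_self, Pi.single_zero, map_zero]

lemma IsFundamental.mem_cayleySpectrum_iff {lam : ℝ} {c s : EdgeSpace} {c1 s1 : ℝ}
    (h : IsFundamental lam c s c1 s1) (hn : ∃ j, n j = 0)
    (e : Γ ≃+ ((j : Fin r) → ZMod (n j))) {vol : ℝ} (hvol : 0 < vol) :
    lam ∈ cayleySpectrum (fun j : Fin r => e.symm (Pi.single j 1)) vol ↔ s1 = 0 ∨
      ∃ θ : Fin r → ℝ, IsCharacterAngle n θ ∧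
        c1 - vol * lam * s1 / (2 * r) = (1 / (r : ℝ)) * ∑ j, Real.cos (θ j) := by
  obtain ⟨j₀, hj₀⟩ := hn
  have hr : (0 : ℝ) < r := by exact_mod_cast j₀.pos
  have hiff : ∀ θ : Fin r → ℝ, c1 - vol * lam * s1 / (2 * r) =
      (1 / (r : ℝ)) * ∑ j, Real.cos (θ j) ↔
      ∑ j, 2 * Real.cos (θ j) = 2 * r * c1 - lam * vol * s1 := by
    intro θ
    rw [← Finset.mul_sum]
    constructor
    · intro h
      field_simp at h
      linarith
    · intro h
      field_simp
      linarith
  by_cases hs1 : s1 = 0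
  · simp only [hs1, true_or, iff_true]
    refine h.mem_cayleySpectrum_of_flow hs1 _ hvol fun η hη =>
      exists_approx_flow n e hj₀ ?_ hη
    have := h.det
    rw [hs1] at this
    have h1 : (c1 - 1) * (c1 + 1) = 0 := by linarith
    rcases mul_eq_zero.1 h1 with h2 | h2
    · exact Or.inl (by linarith)
    · exact Or.inr (by linarith)
  · rw [or_iff_right hs1]
    constructor
    · intro hmem
      by_contra hno
      obtain ⟨K, hK0, hK⟩ := adjacency_bound _ n (nsmul_generator e)
        (2 * r * c1 - lam * vol * s1) fun θ hθ h2 => hno ⟨θ, hθ, (hiff θ).2 h2⟩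
      exact h.not_mem_cayleySpectrum hs1 _ hvol hK0 hK hmem
    · rintro ⟨θ, hθ, h2⟩
      refine h.mem_cayleySpectrum_of_adjacency hs1 _ hvol fun η hη => ?_
      rw [← (hiff θ).1 h2]
      exact exists_approx_adjacency n e hθ hη

end cayley

/-! ### Means of cosines, and gaps of closed sets. -/

section dispersion

variable {r : ℕ} {n : Fin r → ℕ}

lemma mean_cos_le_one (θ : Fin r → ℝ) : (1 / (r : ℝ)) * ∑ j, Real.cos (θ j) ≤ 1 := by
  have h1 : ∑ j, Real.cos (θ j) ≤ r := by
    refine (Finset.sum_le_sum fun j _ => Real.cos_le_one (θ j)).trans ?_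
    simp
  rw [one_div_mul_eq_div]
  exact div_le_one_of_le₀ h1 (by positivity)

lemma neg_one_le_mean_cos (θ : Fin r → ℝ) : -1 ≤ (1 / (r : ℝ)) * ∑ j, Real.cos (θ j) := by
  have h1 : -(r : ℝ) ≤ ∑ j, Real.cos (θ j) := by
    refine le_trans ?_ (Finset.sum_le_sum fun j _ => Real.neg_one_le_cos (θ j))
    simp
  rcases Nat.eq_zero_or_pos r with rfl | hr
  · simp
  · have hr' : (0 : ℝ) < r := by exact_mod_cast hr
    rw [one_div_mul_eq_div, le_div_iff₀ hr']
    linarith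

/-- The set of the mean values of `cos` at the characters. -/
def characterMeans (n : Fin r → ℕ) : Set ℝ :=
  {t | ∃ θ : Fin r → ℝ, IsCharacterAngle n θ ∧ t = (1 / (r : ℝ)) * ∑ j, Real.cos (θ j)}

/-- Angles matter only modulo `2π`, and the character condition is closed, so the set is a
continuous image of a compact set. -/
lemma isClosed_characterMeans (n : Fin r → ℕ) : IsClosed (characterMeans n) := by
  have hK : IsCompact (Set.Icc (0 : Fin r → ℝ) (fun _ => 2 * Real.pi) ∩
      {θ | IsCharacterAngle n θ}) := by
    refine isCompact_Icc.inter_right ?_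
    have : {θ : Fin r → ℝ | IsCharacterAngle n θ} =
        ⋂ j, {θ | (n j : ℝ) * θ j / (2 * Real.pi) ∈ Set.range ((↑) : ℤ → ℝ)} := by
      ext θ
      simp only [Set.mem_ofPred_eq, IsCharacterAngle, Set.mem_iInter, Set.mem_range]
      refine forall_congr' fun j => exists_congr fun m => ?_
      rw [eq_div_iff (by positivity)]
      constructor <;> intro h <;> linarith
    rw [this]
    refine isClosed_iInter fun j => ?_
    exact Int.isClosedEmbedding_coe_real.isClosed_range.preimage (by fun_prop)
  have himg : characterMeans n = (fun θ : Fin r → ℝ => (1 / (r : ℝ)) * ∑ j, Real.cos (θ j)) ''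
      (Set.Icc (0 : Fin r → ℝ) (fun _ => 2 * Real.pi) ∩ {θ | IsCharacterAngle n θ}) := by
    ext t
    constructor
    · rintro ⟨θ, hθ, rfl⟩
      have hpi := Real.two_pi_pos
      refine ⟨fun j => θ j - ⌊θ j / (2 * Real.pi)⌋ * (2 * Real.pi), ⟨⟨fun j => ?_, fun j => ?_⟩,
        fun j => ?_⟩, ?_⟩
      · have := Int.floor_le (θ j / (2 * Real.pi))
        rw [le_div_iff₀ hpi] at this
        exact sub_nonneg.2 this
      · have := (Int.lt_floor_add_one (θ j / (2 * Real.pi))).le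
        rw [div_le_iff₀ hpi] at this
        change θ j - ⌊θ j / (2 * Real.pi)⌋ * (2 * Real.pi) ≤ 2 * Real.pi
        linarith
      · obtain ⟨m, hm⟩ := hθ j
        refine ⟨m - n j * ⌊θ j / (2 * Real.pi)⌋, ?_⟩
        push_cast
        linear_combination hm
      · simp only [Real.cos_sub_int_mul_two_pi]
    · rintro ⟨θ, ⟨_, hθ⟩, rfl⟩
      exact ⟨θ, hθ, rfl⟩
  rw [himg]
  exact (hK.image (by fun_prop)).isClosed

/-- Mean `-1` forces every `θ j` to be an odd multiple of `π`; for odd `n j` the product `n j * θ j`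
is then not in `2πℤ`. -/
lemma neg_one_notMem_characterMeans (hodd : ∃ j, Odd (n j)) : (-1 : ℝ) ∉ characterMeans n := by
  rintro ⟨θ, hθ, h⟩
  obtain ⟨j, hj⟩ := hodd
  have hr : (0 : ℝ) < r := by exact_mod_cast j.pos
  have hsum : ∑ j, (Real.cos (θ j) + 1) = 0 := by
    rw [Finset.sum_add_distrib]
    field_simp at h
    simp only [Finset.sum_const, Finset.card_univ, Fintype.card_fin, nsmul_eq_mul, mul_one]
    linarith
  have hcos := (Finset.sum_eq_zero_iff_of_nonneg fun j _ => by
    linarith [Real.neg_one_le_cos (θ j)]).1 hsum j (Finset.mem_univ j)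
  obtain ⟨k, hk⟩ := Real.cos_eq_neg_one_iff.1 (by linarith : Real.cos (θ j) = -1)
  obtain ⟨m, hm⟩ := hθ j
  obtain ⟨i, hi⟩ := hj
  rw [← hk] at hm
  have h1 : (((n j : ℤ) * (1 + 2 * k) : ℤ) : ℝ) * Real.pi = ((2 * m : ℤ) : ℝ) * Real.pi := by
    push_cast
    linear_combination hm
  have h2 : (n j : ℤ) * (1 + 2 * k) = 2 * m := by
    exact_mod_cast mul_right_cancel₀ Real.pi_ne_zero h1
  rw [hi] at h2
  push_cast at h2
  have h3 : (2 * (i : ℤ) + 1) * (1 + 2 * k) = 2 * (i + 2 * i * k + k) + 1 := by ring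
  omega

lemma exists_isSpectralGap {S : Set ℝ} (hS : IsClosed S) {x u v : ℝ} (hx : x ∉ S) (hu : u ∈ S)
    (hux : u < x) (hv : v ∈ S) (hxv : x < v) :
    ∃ a b, IsSpectralGap S a b ∧ u ≤ a ∧ a < x ∧ x < b ∧ b ≤ v := by
  obtain ⟨a, ⟨haS, ha⟩, ha'⟩ := ((isCompact_Icc (a := u) (b := x)).inter_left hS).exists_isGreatest
    ⟨u, hu, le_rfl, hux.le⟩
  obtain ⟨b, ⟨hbS, hb⟩, hb'⟩ := ((isCompact_Icc (a := x) (b := v)).inter_left hS).exists_isLeast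
    ⟨v, hv, hxv.le, le_rfl⟩
  have hax : a < x := lt_of_le_of_ne ha.2 fun h => hx (h ▸ haS)
  have hxb : x < b := lt_of_le_of_ne hb.1 fun h => hx (h ▸ hbS)
  refine ⟨a, b, ⟨hax.trans hxb, haS, hbS, ?_⟩, ha.1, hax, hxb, hb.2⟩
  rw [Set.disjoint_left]
  rintro y ⟨hay, hyb⟩ hyS
  rcases le_total y x with h | h
  · exact absurd (ha' ⟨hyS, (ha.1.trans hay.le), h⟩) (not_le.2 hay)
  · exact absurd (hb' ⟨hyS, h, hyb.le.trans hb.2⟩) (not_le.2 hyb)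

/-- Gaps on both sides of an isolated point. -/
lemma exists_isSpectralGap_of_isolated {S : Set ℝ} (hS : IsClosed S) {p u v : ℝ} (hp : p ∈ S)
    (hiso : ∀ᶠ x in nhds p, x ∈ S → x = p) (hu : u ∈ S) (hup : u < p) (hv : v ∈ S) (hpv : p < v) :
    (∃ a, IsSpectralGap S a p) ∧ ∃ b, IsSpectralGap S p b := by
  obtain ⟨ε, hε, hball⟩ := Metric.eventually_nhds_iff.1 hiso
  have hne : ∀ x, |x - p| < ε → x ∈ S → x = p := fun x hx => hball (by rwa [Real.dist_eq])
  constructor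
  · set d := min (ε / 2) ((p - u) / 2) with hd
    have hd0 : 0 < d := lt_min (by linarith) (by linarith)
    have hdε : d < ε := (min_le_left _ _).trans_lt (by linarith)
    have hdu : d < p - u := (min_le_right _ _).trans_lt (by linarith)
    have hx : p - d ∉ S := fun h => by
      have := hne (p - d) (by rw [abs_lt]; constructor <;> linarith) h
      linarith
    obtain ⟨a, b, hab, -, -, hxb, hbp⟩ := exists_isSpectralGap hS hx hu (by linarith) hp
      (by linarith)
    have : b = p := hne b (by rw [abs_lt]; constructor <;> linarith) hab.2.2.1
    exact ⟨a, this ▸ hab⟩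
  · set d := min (ε / 2) ((v - p) / 2) with hd
    have hd0 : 0 < d := lt_min (by linarith) (by linarith)
    have hdε : d < ε := (min_le_left _ _).trans_lt (by linarith)
    have hdv : d < v - p := (min_le_right _ _).trans_lt (by linarith)
    have hx : p + d ∉ S := fun h => by
      have := hne (p + d) (by rw [abs_lt]; constructor <;> linarith) h
      linarith
    obtain ⟨a, b, hab, hpa, hax, -, -⟩ := exists_isSpectralGap hS hx hp (by linarith) hv
      (by linarith)
    have : a = p := hne a (by rw [abs_lt]; constructor <;> linarith) hab.2.1
    exact ⟨b, this ▸ hab⟩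

end dispersion

/-! ### The dispersion relation. -/

section main

variable {Γ : Type*} [AddCommGroup Γ] {r : ℕ} {n : Fin r → ℕ}

/-- The dispersion relation. -/
lemma mem_cayleySpectrum_iff (hn : ∃ j, n j = 0) (e : Γ ≃+ ((j : Fin r) → ZMod (n j))) {vol : ℝ}
    (hvol : 0 < vol) (lam : ℝ) :
    lam ∈ cayleySpectrum (fun j : Fin r => e.symm (Pi.single j 1)) vol ↔
      ∃ ω : ℝ, 0 ≤ ω ∧ lam = ω ^ 2 ∧ ((∃ k : ℕ, 1 ≤ k ∧ ω = k * Real.pi) ∨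
        ∃ θ : Fin r → ℝ, IsCharacterAngle n θ ∧
          Real.cos ω - vol * ω * Real.sin ω / (2 * r) = (1 / (r : ℝ)) * ∑ j, Real.cos (θ j)) := by
  have hr : (0 : ℝ) < r := by
    obtain ⟨j, _⟩ := hn
    exact_mod_cast j.pos
  rcases lt_or_ge lam 0 with hlam | hlam
  · set κ := Real.sqrt (-lam) with hκ
    have hκ0 : 0 < κ := Real.sqrt_pos.2 (by linarith)
    have hκ2 : κ ^ 2 = -lam := Real.sq_sqrt (by linarith)
    obtain ⟨c, s, h⟩ := exists_isFundamental (lam := lam) (C := fun x => Real.cosh (κ * x))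
      (S := fun x => Real.sinh (κ * x) / κ)
      (fun x => ((hasDerivAt_id' x).const_mul κ).cosh.congr_deriv (by
        rw [← hκ2]; field_simp))
      (fun x => (((hasDerivAt_id' x).const_mul κ).sinh.div_const κ).congr_deriv (by field_simp))
      (by simp) (by simp) (by
        rw [div_pow, hκ2, Real.cosh_sq]
        have : lam ≠ 0 := hlam.ne
        field_simp
        ring)
    rw [h.mem_cayleySpectrum_iff hn e hvol]
    have hs : 0 < Real.sinh (κ * 1) / κ := div_pos (Real.sinh_pos_iff.2 (by linarith)) hκ0
    constructor
    · rintro (h0 | ⟨θ, -, hθ⟩)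
      · exact absurd h0 hs.ne'
      · exfalso
        have h1 := mean_cos_le_one θ
        have h2 := Real.one_le_cosh (κ * 1)
        -- For negative `lam` the left side becomes `cosh κ` plus this positive term, hence exceeds
        -- `1` and every mean of cosines.
        have h3 : 0 < vol * -lam * (Real.sinh (κ * 1) / κ) / (2 * r) := by
          have : 0 < -lam := by linarith
          positivity
        have h4 : vol * lam * (Real.sinh (κ * 1) / κ) / (2 * r) =
          -(vol * -lam * (Real.sinh (κ * 1) / κ) / (2 * r)) := by ring
        rw [h4] at hθ
        linarith
    · rintro ⟨ω, -, h0, -⟩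
      nlinarith
  · set κ := Real.sqrt lam with hκ
    have hκ2 : κ ^ 2 = lam := Real.sq_sqrt hlam
    have hω : ∀ P : ℝ → Prop, (∃ ω : ℝ, 0 ≤ ω ∧ lam = ω ^ 2 ∧ P ω) ↔ P κ := by
      intro P
      constructor
      · rintro ⟨ω, h0, h1, h2⟩
        rwa [hκ, h1, Real.sqrt_sq h0]
      · exact fun h => ⟨κ, Real.sqrt_nonneg _, hκ2.symm, h⟩
    rw [hω]
    rcases hlam.eq_or_lt with h0 | hpos
    · have hκ0 : κ = 0 := by rw [hκ, ← h0, Real.sqrt_zero]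
      obtain ⟨c, s, h⟩ := exists_isFundamental (lam := lam) (C := fun _ => 1) (S := fun x => x)
        (fun x => (hasDerivAt_const x (1 : ℝ)).congr_deriv (by rw [← h0]; simp))
        (fun x => hasDerivAt_id x) rfl rfl (by rw [← h0]; simp)
      rw [h.mem_cayleySpectrum_iff hn e hvol, hκ0, ← h0]
      refine or_congr ?_ (by simp)
      simp only [one_ne_zero, false_iff, not_exists, not_and]
      intro k hk
      have : (0 : ℝ) < k := by exact_mod_cast hk
      positivity
    · have hκ0 : 0 < κ := Real.sqrt_pos.2 hpos
      obtain ⟨c, s, h⟩ := exists_isFundamental (lam := lam) (C := fun x => Real.cos (κ * x))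
        (S := fun x => Real.sin (κ * x) / κ)
        (fun x => ((hasDerivAt_id' x).const_mul κ).cos.congr_deriv (by
          rw [← hκ2]; field_simp))
        (fun x => (((hasDerivAt_id' x).const_mul κ).sin.div_const κ).congr_deriv (by field_simp))
        (by simp) (by simp) (by
          rw [div_pow, hκ2, mul_div_cancel₀ _ hpos.ne']
          exact Real.cos_sq_add_sin_sq _)
      rw [h.mem_cayleySpectrum_iff hn e hvol]
      simp only [mul_one]
      refine or_congr ?_ ?_
      · rw [div_eq_zero_iff, or_iff_left hκ0.ne', Real.sin_eq_zero_iff]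
        constructor
        · rintro ⟨k, hk⟩
          have hk0 : 0 < k := by
            rw [← hk] at hκ0
            exact_mod_cast pos_of_mul_pos_left hκ0 Real.pi_pos.le
          refine ⟨k.toNat, by omega, ?_⟩
          rw [← hk]
          congr 1
          exact_mod_cast (Int.toNat_of_nonneg hk0.le).symm
        · rintro ⟨k, -, hk⟩
          exact ⟨k, by rw [hk]; simp⟩
      · refine exists_congr fun θ => and_congr_right fun _ => ?_
        have : vol * lam * (Real.sin κ / κ) / (2 * r) = vol * κ * Real.sin κ / (2 * r) := by
          rw [← hκ2]
          field_simp
        rw [this]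

end main


/-! ### Spectral gaps. -/

section gaps

variable {r : ℕ} {n : Fin r → ℕ} {vol : ℝ} {S : Set ℝ}

/-- `S` is the set of the `ω²` for which `ω` satisfies the dispersion relation. -/
def IsDispersionSet (n : Fin r → ℕ) (vol : ℝ) (S : Set ℝ) : Prop :=
  ∀ lam : ℝ, lam ∈ S ↔ ∃ ω : ℝ, 0 ≤ ω ∧ lam = ω ^ 2 ∧ ((∃ k : ℕ, 1 ≤ k ∧ ω = k * Real.pi) ∨
    ∃ θ : Fin r → ℝ, IsCharacterAngle n θ ∧
      Real.cos ω - vol * ω * Real.sin ω / (2 * r) = (1 / (r : ℝ)) * ∑ j, Real.cos (θ j))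

lemma one_mem_characterMeans (hr : 0 < r) : (1 : ℝ) ∈ characterMeans n := by
  have hr' : (r : ℝ) ≠ 0 := by exact_mod_cast hr.ne'
  refine ⟨0, fun j => ⟨0, by simp⟩, ?_⟩
  simp [hr']

lemma IsDispersionSet.sq_mem (h : IsDispersionSet n vol S) (hr : 0 < r) (k : ℕ) :
    ((k : ℝ) * Real.pi) ^ 2 ∈ S := by
  refine (h _).2 ⟨k * Real.pi, by positivity, rfl, ?_⟩
  rcases Nat.eq_zero_or_pos k with rfl | hk
  · obtain ⟨θ, hθ, h1⟩ := one_mem_characterMeans (n := n) hr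
    exact Or.inr ⟨θ, hθ, by rw [← h1]; simp⟩
  · exact Or.inl ⟨k, hk, rfl⟩

/-- A form of the relation that is visibly closed in `lam`. The zero `ω = 0` of the sine may be
included since the trivial character puts `0` in `S`; `0 ≤ lam` is needed because `Real.sqrt` is `0`
on negative numbers. -/
lemma IsDispersionSet.mem_iff (h : IsDispersionSet n vol S) (hr : 0 < r) (lam : ℝ) :
    lam ∈ S ↔ 0 ≤ lam ∧ (Real.sin (Real.sqrt lam) = 0 ∨
      Real.cos (Real.sqrt lam) - vol * Real.sqrt lam * Real.sin (Real.sqrt lam) / (2 * r) ∈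
        characterMeans n) := by
  rw [h]
  constructor
  · rintro ⟨ω, h0, rfl, h1⟩
    rw [Real.sqrt_sq h0]
    refine ⟨by positivity, h1.imp ?_ id⟩
    rintro ⟨k, -, rfl⟩
    exact Real.sin_nat_mul_pi k
  · rintro ⟨h0, h1⟩
    refine ⟨Real.sqrt lam, Real.sqrt_nonneg _, (Real.sq_sqrt h0).symm, ?_⟩
    rcases h1 with h1 | h1
    · obtain ⟨k, hk⟩ := Real.sin_eq_zero_iff.1 h1
      have hk0 : 0 ≤ k := by
        have := Real.sqrt_nonneg lam
        rw [← hk] at this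
        exact_mod_cast nonneg_of_mul_nonneg_left this Real.pi_pos
      rcases hk0.eq_or_lt with h2 | h2
      · rw [← h2, Int.cast_zero, zero_mul] at hk
        obtain ⟨θ, hθ, h3⟩ := one_mem_characterMeans (n := n) hr
        exact Or.inr ⟨θ, hθ, by rw [← h3, ← hk]; simp⟩
      · refine Or.inl ⟨k.toNat, by omega, ?_⟩
        rw [← hk]
        congr 1
        exact_mod_cast (Int.toNat_of_nonneg hk0).symm
    · exact Or.inr h1

lemma IsDispersionSet.isClosed (h : IsDispersionSet n vol S) (hr : 0 < r) : IsClosed S := by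
  have : S = {lam | 0 ≤ lam} ∩ ({lam | Real.sin (Real.sqrt lam) = 0} ∪
      {lam | Real.cos (Real.sqrt lam) - vol * Real.sqrt lam * Real.sin (Real.sqrt lam) / (2 * r) ∈
        characterMeans n}) := by
    ext lam
    exact h.mem_iff hr lam
  rw [this]
  refine (isClosed_le continuous_const continuous_id).inter
    ((isClosed_eq (by fun_prop) continuous_const).union ?_)
  exact (isClosed_characterMeans n).preimage (f := fun lam : ℝ => Real.cos (Real.sqrt lam) -
    vol * Real.sqrt lam * Real.sin (Real.sqrt lam) / (2 * r)) (by fun_prop)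

/-- At `ω = lπ + π/2` the cosine vanishes and the left side has modulus `vol ω / (2r) > 1`, since `ω
≥ l`. The enclosing points `(lπ)²` and `((l+1)π)²` of `S` confine the gap, which later separates the
gaps for different `l`. -/
lemma IsDispersionSet.exists_gap (h : IsDispersionSet n vol S) (hr : 0 < r) (hvol : 0 < vol)
    {l : ℕ} (hl : 2 * r < vol * l) : ∃ a b : ℝ, IsSpectralGap S a b ∧
      a < (2 * (l : ℝ) + 1) ^ 2 * Real.pi ^ 2 / 4 ∧ (2 * (l : ℝ) + 1) ^ 2 * Real.pi ^ 2 / 4 < b ∧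
      (l * Real.pi) ^ 2 ≤ a ∧ b ≤ ((l + 1) * Real.pi) ^ 2 := by
  have hr' : (0 : ℝ) < r := by exact_mod_cast hr
  have hpi := Real.pi_pos
  have hpi3 := Real.pi_gt_three
  have hl0 : (0 : ℝ) ≤ l := Nat.cast_nonneg l
  set ω : ℝ := l * Real.pi + Real.pi / 2 with hω
  have hω0 : 0 < ω := by positivity
  have hω2 : (2 * (l : ℝ) + 1) ^ 2 * Real.pi ^ 2 / 4 = ω ^ 2 := by rw [hω]; ring
  have hcos : Real.cos ω = 0 := by
    rw [Real.cos_eq_zero_iff]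
    exact ⟨l, by rw [hω]; push_cast; ring⟩
  have hsin : |Real.sin ω| = 1 := by
    have := Real.cos_sq_add_sin_sq ω
    rw [hcos] at this
    rw [← sq_eq_sq₀ (abs_nonneg _) zero_le_one, sq_abs]
    linarith
  have hx : ω ^ 2 ∉ S := by
    rw [h.mem_iff hr, Real.sqrt_sq hω0.le]
    rintro ⟨-, h1 | ⟨θ, -, h1⟩⟩
    · rw [h1, abs_zero] at hsin
      exact zero_ne_one hsin
    · have h2 := mean_cos_le_one θ
      have h3 := neg_one_le_mean_cos θ
      rw [← h1] at h2 h3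
      have h4 : |Real.cos ω - vol * ω * Real.sin ω / (2 * r)| ≤ 1 := abs_le.2 ⟨h3, h2⟩
      rw [hcos, zero_sub, abs_neg, abs_div, abs_mul, hsin, mul_one, abs_of_pos (by positivity),
        abs_of_pos (by positivity), div_le_one (by positivity)] at h4
      have h5 : vol * l ≤ vol * ω := by
        gcongr
        rw [hω]
        nlinarith
      linarith
  obtain ⟨a, b, hab, h1, h2, h3, h4⟩ := exists_isSpectralGap (h.isClosed hr) hx (h.sq_mem hr l)
    (by gcongr; rw [hω]; linarith) (h.sq_mem hr (l + 1))
    (by gcongr; rw [hω]; push_cast; linarith)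
  rw [hω2]
  exact ⟨a, b, hab, h2, h3, h1, by push_cast at h4; exact h4⟩

lemma IsDispersionSet.infinite_gaps (h : IsDispersionSet n vol S) (hr : 0 < r) (hvol : 0 < vol) :
    {I : ℝ × ℝ | IsSpectralGap S I.1 I.2 ∧ ∃ l : ℕ,
      I.1 < (2 * (l : ℝ) + 1) ^ 2 * Real.pi ^ 2 / 4 ∧
      (2 * (l : ℝ) + 1) ^ 2 * Real.pi ^ 2 / 4 < I.2}.Infinite := by
  obtain ⟨L, hL⟩ := exists_nat_gt (2 * r / vol)
  rw [div_lt_iff₀ hvol] at hL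
  have hLl : ∀ l : ℕ, 2 * r < vol * (L + l : ℕ) := fun l => by
    push_cast
    nlinarith [(Nat.cast_nonneg l : (0 : ℝ) ≤ l)]
  choose a b hab h1 h2 h3 h4 using fun l => h.exists_gap hr hvol (hLl l)
  have hlt : ∀ l m : ℕ, l < m → a l < a m := by
    intro l m hlm
    refine lt_of_lt_of_le ((hab l).1.trans_le (h4 l)) (le_trans ?_ (h3 m))
    have : ((L + l : ℕ) : ℝ) + 1 ≤ (L + m : ℕ) := by exact_mod_cast (by omega)
    have hpi := Real.pi_pos
    gcongr
  have hmono : StrictMono a := fun l m hlm => hlt l m hlm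
  refine Set.infinite_of_injective_forall_mem (f := fun l => (a l, b l))
    (fun l m hlm => hmono.injective (Prod.ext_iff.1 hlm).1) fun l => ⟨hab l, _, h1 l, h2 l⟩

/-- Near `ω = (2l+1)π` the left side stays close to `-1`, outside the closed set of means, and the
other zeros of the sine are at distance at least `π`. So the point is isolated in `S`, with `0` and
`((2l+2)π)²` as spectrum on either side. -/
lemma IsDispersionSet.exists_adjacent_gaps (h : IsDispersionSet n vol S) (hr : 0 < r)
    (hodd : ∃ j, Odd (n j)) (l : ℕ) :
    (∃ a : ℝ, IsSpectralGap S a ((2 * (l : ℝ) + 1) ^ 2 * Real.pi ^ 2)) ∧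
      ∃ b : ℝ, IsSpectralGap S ((2 * (l : ℝ) + 1) ^ 2 * Real.pi ^ 2) b := by
  have hpi := Real.pi_pos
  have hp : (2 * (l : ℝ) + 1) ^ 2 * Real.pi ^ 2 = (((2 * l + 1 : ℕ) : ℝ) * Real.pi) ^ 2 := by
    push_cast
    ring
  rw [hp]
  set ω : ℝ := ((2 * l + 1 : ℕ) : ℝ) * Real.pi with hω
  have hω0 : 0 < ω := by positivity
  have hcos : Real.cos ω = -1 := by
    rw [hω, Real.cos_nat_mul_pi, Odd.neg_one_pow ⟨l, rfl⟩]
  have hsin : Real.sin ω = 0 := Real.sin_nat_mul_pi _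
  refine exists_isSpectralGap_of_isolated (h.isClosed hr) (h.sq_mem hr _) ?_ (h.sq_mem hr 0)
    (by simpa using pow_pos hω0 2) (h.sq_mem hr (2 * l + 2))
    (by rw [hω]; push_cast; gcongr; linarith)
  have hcont : ContinuousAt (fun lam : ℝ => Real.cos (Real.sqrt lam) -
    vol * Real.sqrt lam * Real.sin (Real.sqrt lam) / (2 * r)) (ω ^ 2) :=
      Continuous.continuousAt (by fun_prop)
  have h1 : ∀ᶠ lam in nhds (ω ^ 2), Real.cos (Real.sqrt lam) -
      vol * Real.sqrt lam * Real.sin (Real.sqrt lam) / (2 * r) ∉ characterMeans n := by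
    refine hcont.eventually_mem ((isClosed_characterMeans n).isOpen_compl.mem_nhds ?_)
    rw [Real.sqrt_sq hω0.le, hcos, hsin, mul_zero, zero_div, sub_zero]
    exact neg_one_notMem_characterMeans hodd
  have h2 : ∀ᶠ lam in nhds (ω ^ 2), Real.sqrt lam ∈ Set.Ioo (ω - Real.pi) (ω + Real.pi) := by
    refine (Real.continuous_sqrt.continuousAt (x := ω ^ 2)).eventually_mem (Ioo_mem_nhds ?_ ?_) <;>
      rw [Real.sqrt_sq hω0.le] <;> linarith
  filter_upwards [h1, h2] with lam h1 h2 hlam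
  rw [h.mem_iff hr] at hlam
  obtain ⟨h0, h3 | h3⟩ := hlam
  · obtain ⟨k, hk⟩ := Real.sin_eq_zero_iff.1 h3
    rw [← hk, hω] at h2
    have h4 : ((2 * l + 1 : ℕ) : ℝ) - 1 < k := by
      refine lt_of_mul_lt_mul_right ?_ hpi.le
      linarith [h2.1]
    have h5 : (k : ℝ) < ((2 * l + 1 : ℕ) : ℝ) + 1 := by
      refine lt_of_mul_lt_mul_right ?_ hpi.le
      linarith [h2.2]
    have h6 : k = ((2 * l + 1 : ℕ) : ℤ) := by
      have h7 : ((2 * l + 1 : ℕ) : ℤ) - 1 < k := by exact_mod_cast h4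
      have h8 : k < ((2 * l + 1 : ℕ) : ℤ) + 1 := by exact_mod_cast h5
      omega
    rw [← Real.sq_sqrt h0, ← hk, hω, h6, Int.cast_natCast]
  · exact absurd h3 h1

end gaps

end BorderlineGraph

end

theorem mainTheorem7 {Γ : Type*} [AddCommGroup Γ] {r : ℕ} (n : Fin r → ℕ)
    (hn : ∃ j, n j = 0) (e : Γ ≃+ ((j : Fin r) → ZMod (n j))) (vol : ℝ) (hvol : 0 < vol)
    (S : Set ℝ)
    (hS : S = BorderlineGraph.cayleySpectrum (fun j : Fin r => e.symm (Pi.single j 1)) vol) :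
    -- the dispersion relation
    (∀ lam : ℝ, lam ∈ S ↔ ∃ ω : ℝ, 0 ≤ ω ∧ lam = ω ^ 2 ∧
      ((∃ k : ℕ, 1 ≤ k ∧ ω = k * Real.pi) ∨
        ∃ θ : Fin r → ℝ, BorderlineGraph.IsCharacterAngle n θ ∧
          Real.cos ω - vol * ω * Real.sin ω / (2 * r) = (1 / (r : ℝ)) * ∑ j, Real.cos (θ j))) ∧
    -- infinitely many gaps, around (2l+1)²π²/4 for all large l
    (∃ L : ℕ, ∀ l : ℕ, L ≤ l → ∃ a b : ℝ, BorderlineGraph.IsSpectralGap S a b ∧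
      a < (2 * (l : ℝ) + 1) ^ 2 * Real.pi ^ 2 / 4 ∧
      (2 * (l : ℝ) + 1) ^ 2 * Real.pi ^ 2 / 4 < b) ∧
    {I : ℝ × ℝ | BorderlineGraph.IsSpectralGap S I.1 I.2 ∧ ∃ l : ℕ,
      I.1 < (2 * (l : ℝ) + 1) ^ 2 * Real.pi ^ 2 / 4 ∧
      (2 * (l : ℝ) + 1) ^ 2 * Real.pi ^ 2 / 4 < I.2}.Infinite ∧
    -- gaps directly below and above (2l+1)²π² if some cyclic factor has odd order
    ((∃ j, Odd (n j)) → ∀ l : ℕ,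
      (∃ a : ℝ, BorderlineGraph.IsSpectralGap S a ((2 * (l : ℝ) + 1) ^ 2 * Real.pi ^ 2)) ∧
      (∃ b : ℝ, BorderlineGraph.IsSpectralGap S ((2 * (l : ℝ) + 1) ^ 2 * Real.pi ^ 2) b)) := by
  subst hS
  have hr : 0 < r := by
    obtain ⟨j, _⟩ := hn
    exact j.pos
  have h : BorderlineGraph.IsDispersionSet n vol (BorderlineGraph.cayleySpectrum
      (fun j : Fin r => e.symm (Pi.single j 1)) vol) :=
    fun lam => BorderlineGraph.mem_cayleySpectrum_iff hn e hvol lam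
  refine ⟨h, ?_, h.infinite_gaps hr hvol, fun hodd l => h.exists_adjacent_gaps hr hodd l⟩
  obtain ⟨L, hL⟩ := exists_nat_gt (2 * r / vol)
  rw [div_lt_iff₀ hvol] at hL
  refine ⟨L, fun l hl => ?_⟩
  have hl' : (L : ℝ) ≤ l := by exact_mod_cast hl
  obtain ⟨a, b, hab, h1, h2, -, -⟩ := h.exists_gap hr hvol (l := l) (by nlinarith)
  exact ⟨a, b, hab, h1, h2⟩
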